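/- Let $N\ge 1$, let $f_1,\dots,f_N:\mathbb R^d\to\mathbb R$ be convex and differentiable, with $\nabla f_i$ Lipschitz continuous with constant $L_i>0$, and let $g:\mathbb R^d\to\mathbb R\cup\{+\infty\}$ be convex, closed and proper. Put $F=\frac1N\sum_{i=1}^N f_i$ and assume that the set $\mathcal X^\star$ of minimizers of $F+g$ is nonempty. Fix $\lambda>0$ and write $\operatorname{prox}_{\lambda g}(v)=\operatorname{argmin}_u\big(g(u)+\frac1{2\lambda}\|u-v\|^2\big)$. For $z=(x,y_1,\dots,y_N)\in\mathbb R^{(N+1)d}$ let $$\bar{\mathcal R}z=\Big(x-\operatorname{prox}_{\lambda g}\big(x-\tfrac{\lambda}{N}\textstyle\sum_{i}y_i\big),\ y_1-\nabla f_1(x),\ \dots,\ y_N-\nabla f_N(x)\Big),\qquad \operatorname{zer}\bar{\mathcal R}=\{z:\bar{\mathcal R}z=0\}.$$ Let $p_i>0$ and $\rho_i>0$ for $i=1,\dots,N$, let $(\mathcal F_k)_{k\ge0}$ be a filtration on a probability space, and write $\mathbb E_k=\mathbb E[\,\cdot\mid\mathcal F_k]$. For every $k\ge 0$ let $i_k\in\{1,\dots,N\}$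 and $\varepsilon_1^k,\dots,\varepsilon_N^k\in\{0,1\}$ be $\mathcal F_{k+1}$-measurable random variables such that, for all $j$, almost surely $\mathbb P(i_k=j\mid\mathcal F_k)=p_j$ and $\mathbb P(\varepsilon_j^k=1\mid\mathcal F_k)=\rho_j$ (within one iteration $i_k,\varepsilon_1^k,\dots,\varepsilon_N^k$ may depend on each other in any way; SAGA and L-SVRG are special cases). Let $z^0=(x^0,y_1^0,\dots,y_N^0)$ be an initial point, deterministic or, more generally, $\mathcal F_0$-measurable and square integrable. The basic method generates $z^k=(x^k,y_1^k,\dots,y_N^k)$ by $$x^{k+1}=\operatorname{prox}_{\lambda g}\big(x^k-\lambda\widetilde\nabla_{i_k}F(x^k,y^k)\big),\qquad y_i^{k+1}=y_i^k+\varepsilon_i^k\big(\nabla f_i(x^k)-y_i^k\big)\quad(1\le i\le N),$$ $$\widetilde\nabla_{j}F(x,y)=\tfrac1{Np_j}\big(\nabla f_j(x)-y_j\big)+\tfrac1N\sum_{i=1}^N y_i .$$ Let $\Gamma=\mathrm{blkdiag}\big(I_d,\tfrac{\lambda}{N\rho_1L_1}I_d,\dots,\tfrac{\lambda}{N\rho_NL_N}I_d\big)$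 and $\|z\|_\Gamma=\sqrt{\langle z,\Gamma z\rangle}$. **(a)** For every $z^\star=(x^\star,y_1^\star,\dots,y_N^\star)\in\operatorname{zer}\bar{\mathcal R}$ and every $k\ge0$, the random variables inside the conditional expectations below are integrable, and almost surely $$\mathbb E_k\|z^{k+1}-z^\star\|_\Gamma^2\le\|z^k-z^\star\|_\Gamma^2-\zeta_k,$$ where $$\begin{aligned}\zeta_k={}&\sum_{i=1}^N\tfrac{\lambda}{N}\Big(\tfrac1{L_i}-\tfrac{2\lambda}{Np_i}\Big)\Big(\|\nabla f_i(x^k)-\nabla f_i(x^\star)\|^2+\|y_i^k-y_i^\star\|^2\Big)+\tfrac{2\lambda^2}{N^2}\Big\|\sum_{i=1}^N(y_i^k-y_i^\star)\Big\|^2\\&+\lambda^2\|\nabla F(x^k)-\nabla F(x^\star)\|^2+\mathbb E_k\big\|x^{k+1}-x^k+\lambda\big(\widetilde\nabla_{i_k}F(x^k,y^k)-\nabla F(x^\star)\big)\big\|^2.\end{aligned}$$ **(b)** If moreover $\lambda<\min_{1\le i\le N}\frac{Np_i}{2L_i}$, then there are a $\operatorname{zer}\bar{\mathcal R}$-valued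 random variable $\bar z$ and an $\mathcal X^\star$-valued random variable $\bar x$ such that, almost surely, $z^k\to\bar z$, $x^k\to\bar x$, and $y_i^k\to\nabla f_i(\bar x)$ for every $i$. -/

import Mathlib

open MeasureTheory ProbabilityTheory Filter Topology
open scoped Gradient

noncomputable section

namespace BasicMethod

/-- The primal space `ℝ^d` with its Euclidean structure. -/
abbrev Primal (d : ℕ) : Type := EuclideanSpace ℝ (Fin d)

/-- The primal-dual space `ℝ^{(N+1)d}` of points `z = (x, y_1, …, y_N)`, with its Euclidean
structure. -/
abbrev PrimalDual (d N : ℕ) : Type := WithLp 2 (Primal d × PiLp 2 (fun _ : Fin N => Primal d))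

/-- An extended-real-valued function is convex if its epigraph is convex. -/
def IsConvexFun {d : ℕ} (g : Primal d → EReal) : Prop :=
  Convex ℝ {q : Primal d × ℝ | g q.1 ≤ (q.2 : EReal)}

/-- A function into `ℝ ∪ {+∞}` is proper if it is not identically `+∞`. -/
def IsProperFun {d : ℕ} (g : Primal d → EReal) : Prop :=
  (∀ x, g x ≠ ⊥) ∧ ∃ x, g x ≠ ⊤

/-- `f` is `L`-smooth: differentiable with `L`-Lipschitz gradient. -/
def IsSmoothFun {d : ℕ} (L : ℝ) (f : Primal d → ℝ) : Prop :=
  Differentiable ℝ f ∧ ∀ x y, ‖∇ f x - ∇ f y‖ ≤ L * ‖x - y‖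

/-- The average `F = (1/N) ∑ f_i`. -/
def avg {d N : ℕ} (f : Fin N → Primal d → ℝ) (x : Primal d) : ℝ :=
  (1 / (N : ℝ)) * ∑ i, f i x

/-- The solution set of `minimize F(x) + g(x)` over `ℝ^d`. -/
def solutionSet {d N : ℕ} (f : Fin N → Primal d → ℝ) (g : Primal d → EReal) :
    Set (Primal d) :=
  {x | ∀ u, ((avg f x : ℝ) : EReal) + g x ≤ ((avg f u : ℝ) : EReal) + g u}

/-- The standing assumptions on the problem. -/
structure ProblemAssumptions {d N : ℕ} (f : Fin N → Primal d → ℝ) (L : Fin N → ℝ)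
    (g : Primal d → EReal) : Prop where
  convex_f : ∀ i, ConvexOn ℝ Set.univ (f i)
  L_pos : ∀ i, 0 < L i
  smooth_f : ∀ i, IsSmoothFun (L i) (f i)
  convex_g : IsConvexFun g
  closed_g : LowerSemicontinuous g
  proper_g : IsProperFun g
  solvable : (solutionSet f g).Nonempty

open Classical in
/-- `prox_{lam g}(v)`, a minimizer of `u ↦ g(u) + ‖u - v‖² / (2 lam)`. For `lam > 0` and `g` convex,
closed and proper the minimizer exists and is unique; the value `0` in the other case is never
used. -/
def prox {d : ℕ} (lam : ℝ) (g : Primal d → EReal) (v : Primal d) : Primal d :=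
  if h : ∃ q : Primal d, ∀ u : Primal d,
      g q + ((1 / (2 * lam) * ‖q - v‖ ^ 2 : ℝ) : EReal) ≤
        g u + ((1 / (2 * lam) * ‖u - v‖ ^ 2 : ℝ) : EReal)
  then h.choose else 0

/-- The point `(x, y_1, …, y_N)`. -/
def mkPoint {d N : ℕ} (x : Primal d) (y : Fin N → Primal d) : PrimalDual d N :=
  WithLp.toLp 2 (x, WithLp.toLp 2 y)

/-- The primal component `x` of `z`. -/
def primal {d N : ℕ} (z : PrimalDual d N) : Primal d := z.fst

/-- The `i`-th dual component `y_i` of `z`. -/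
def dual {d N : ℕ} (z : PrimalDual d N) (i : Fin N) : Primal d := z.snd i

/-- The primal-dual residual mapping. -/
def residual {d N : ℕ} (f : Fin N → Primal d → ℝ) (g : Primal d → EReal) (lam : ℝ)
    (z : PrimalDual d N) : PrimalDual d N :=
  mkPoint
    (primal z - prox lam g (primal z - (lam / (N : ℝ)) • ∑ i, dual z i))
    (fun i => dual z i - ∇ (f i) (primal z))

/-- The zero set of the primal-dual residual mapping. -/
def zer {d N : ℕ} (f : Fin N → Primal d → ℝ) (g : Primal d → EReal) (lam : ℝ) :
    Set (PrimalDual d N) :=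
  {z | residual f g lam z = 0}

/-- The block-diagonal operator `Γ = blkdiag(I, lam/(N ρ_1 L_1) I, …, lam/(N ρ_N L_N) I)`. -/
def gammaOp {d N : ℕ} (lam : ℝ) (ρ L : Fin N → ℝ) (z : PrimalDual d N) : PrimalDual d N :=
  mkPoint (primal z) (fun i => (lam / ((N : ℝ) * ρ i * L i)) • dual z i)

/-- The weighted norm `‖z‖_Γ = √⟨z, Γ z⟩`. -/
def gammaNorm {d N : ℕ} (lam : ℝ) (ρ L : Fin N → ℝ) (z : PrimalDual d N) : ℝ :=
  √(inner ℝ z (gammaOp lam ρ L z))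

/-- The stochastic approximation
`(∇ f_j(x) - y_j) / (N p_j) + (1/N) ∑ y_i` of `∇ F(x)` for the sampled index `j`. -/
def stochGrad {d N : ℕ} (f : Fin N → Primal d → ℝ) (p : Fin N → ℝ) (j : Fin N)
    (z : PrimalDual d N) : Primal d :=
  (1 / ((N : ℝ) * p j)) • (∇ (f j) (primal z) - dual z j) + (1 / (N : ℝ)) • ∑ i, dual z i

/-- One step of the basic method from `z`, with sampled index `j` and dual update variables `e`. -/
def step {d N : ℕ} (f : Fin N → Primal d → ℝ) (g : Primal d → EReal) (lam : ℝ)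
    (p : Fin N → ℝ) (j : Fin N) (e : Fin N → ℝ) (z : PrimalDual d N) : PrimalDual d N :=
  mkPoint
    (prox lam g (primal z - lam • stochGrad f p j z))
    (fun i => dual z i + e i • (∇ (f i) (primal z) - dual z i))

/-- The iterates `z^k` of the basic method started at `z0`, driven by the sampled indices `idx k` and
the dual update variables `eps k`. -/
def iter {Ω : Type*} {d N : ℕ} (f : Fin N → Primal d → ℝ) (g : Primal d → EReal) (lam : ℝ)
    (p : Fin N → ℝ) (idx : ℕ → Ω → Fin N) (eps : ℕ → Ω → Fin N → ℝ) (z0 : Ω → PrimalDual d N) :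
    ℕ → Ω → PrimalDual d N
  | 0, ω => z0 ω
  | k + 1, ω => step f g lam p (idx k ω) (eps k ω) (iter f g lam p idx eps z0 k ω)

/-- The sampling scheme. `ℱ k` is the information available before the draws of iteration `k`.
Given `ℱ k`, the index `i_k` equals `j` with probability `p_j`, and the binary variable `ε_j^k` is `1`
with probability `ρ_j`. Nothing is assumed on the dependence among `i_k, ε_1^k, …, ε_N^k`
within an iteration. -/
structure IsSampling {Ω : Type*} [mΩ : MeasurableSpace Ω] {N : ℕ} (μ : Measure Ω)
    (ℱ : Filtration ℕ mΩ) (p ρ : Fin N → ℝ) (idx : ℕ → Ω → Fin N)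
    (eps : ℕ → Ω → Fin N → ℝ) : Prop where
  measurable_idx : ∀ k, Measurable[ℱ (k + 1)] (idx k)
  measurable_eps : ∀ k j, Measurable[ℱ (k + 1)] (fun ω => eps k ω j)
  binary : ∀ k ω j, eps k ω j = 0 ∨ eps k ω j = 1
  prob_idx : ∀ k j, μ⟦{ω | idx k ω = j} | ℱ k⟧ =ᵐ[μ] fun _ => p j
  prob_eps : ∀ k j, μ⟦{ω | eps k ω j = 1} | ℱ k⟧ =ᵐ[μ] fun _ => ρ j

/-- The quantity `‖x^{k+1} - x^k + lam (∇̃F(x^k, y^k) - ∇ F(x*))‖²`, where `∇̃F(x^k, y^k)` is the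
stochastic gradient approximation drawn at iteration `k`. -/
def primalIncrement {Ω : Type*} {d N : ℕ} (f : Fin N → Primal d → ℝ) (g : Primal d → EReal)
    (lam : ℝ) (p : Fin N → ℝ) (idx : ℕ → Ω → Fin N) (eps : ℕ → Ω → Fin N → ℝ)
    (z0 : Ω → PrimalDual d N) (zs : PrimalDual d N) (k : ℕ) (ω : Ω) : ℝ :=
  ‖primal (iter f g lam p idx eps z0 (k + 1) ω) - primal (iter f g lam p idx eps z0 k ω)
      + lam • (stochGrad f p (idx k ω) (iter f g lam p idx eps z0 k ω)
        - ∇ (avg f) (primal zs))‖ ^ 2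

/-- The random variable `ζ_k`. -/
def zeta {Ω : Type*} [mΩ : MeasurableSpace Ω] {d N : ℕ} (μ : Measure Ω) (ℱ : Filtration ℕ mΩ)
    (f : Fin N → Primal d → ℝ) (L : Fin N → ℝ) (g : Primal d → EReal)
    (lam : ℝ) (p : Fin N → ℝ) (idx : ℕ → Ω → Fin N) (eps : ℕ → Ω → Fin N → ℝ)
    (z0 : Ω → PrimalDual d N) (zs : PrimalDual d N) (k : ℕ) (ω : Ω) : ℝ :=
  (∑ i, lam / (N : ℝ) * (1 / L i - 2 * lam / ((N : ℝ) * p i)) *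
      (‖∇ (f i) (primal (iter f g lam p idx eps z0 k ω)) - ∇ (f i) (primal zs)‖ ^ 2
        + ‖dual (iter f g lam p idx eps z0 k ω) i - dual zs i‖ ^ 2))
    + 2 * lam ^ 2 / (N : ℝ) ^ 2 *
      ‖∑ i, (dual (iter f g lam p idx eps z0 k ω) i - dual zs i)‖ ^ 2
    + lam ^ 2 *
      ‖∇ (avg f) (primal (iter f g lam p idx eps z0 k ω)) - ∇ (avg f) (primal zs)‖ ^ 2
    + (μ[primalIncrement f g lam p idx eps z0 zs k | ℱ k]) ω

end BasicMethod

end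

/-! Fix a zero z* of the residual. Its primal part is the prox of its own forward step x* - λ∇F(x*),
and its dual parts are the gradients at x*. Write a_i = ∇f_i(x) - ∇f_i(x*) and b_i = y_i - y_i*.
Firm nonexpansiveness of the prox bounds the new primal squared distance by that of the forward
steps minus the primal increment (`gammaNorm_step_sub_sq_le`).

Averaging over the index makes the gradient estimator unbiased. The cross term is then controlled by
cocoercivity of each ∇f_i, which yields -(2λ/N) ∑ ‖a_i‖²/L_i, and the second moment by a variance
inequality (`sum_mul_norm_sub_add_mean_sq_le`). On the dual side the weight λ/(Nρ_iL_i) cancels the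
update probability ρ_i, leaving (λ/(NL_i))(‖a_i‖² - ‖b_i‖²). Half of the cocoercivity gain pays for
the a_i term, so a_i and b_i end up with the same coefficient (`expected_step_le`). Each random term
of the pointwise bound involves only one of the draws, so only their conditional marginals matter;
this gives (a).

For (b), the step-size condition makes ζ_k nonnegative, and almost surely ζ_k is a continuous
function of z^k. The Robbins-Siegmund argument gives, almost surely, convergence of the distance to
a given zero and ζ_k → 0. Applying it to a countable dense set of zeros keeps the exceptional set
null. Cluster points have zero decrease, hence are zeros, and Opial's lemma turns this into
convergence of the whole sequence. -/

section SmoothConvex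

/-! ### Smooth convex functions and cocoercivity -/

variable {E : Type*} [NormedAddCommGroup E] [InnerProductSpace ℝ E] [CompleteSpace E]

/-- The derivative of a differentiable function along an affine line. -/
theorem hasDerivAt_line_gradient {f : E → ℝ} (hf : Differentiable ℝ f) (x v : E)
    (t : ℝ) : HasDerivAt (fun s : ℝ => f (x + s • v)) (inner ℝ (∇ f (x + t • v)) v) t := by
  have h1 : HasDerivAt (fun s : ℝ => x + s • v) v t := by
    simpa using ((hasDerivAt_id t).smul_const v).const_add x
  have h2 := (hf (x + t • v)).hasFDerivAt.comp_hasDerivAt t h1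
  rw [inner_gradient_left]
  exact h2

/-- The first order inequality for differentiable convex functions. -/
theorem ConvexOn.add_inner_gradient_le {f : E → ℝ} (hc : ConvexOn ℝ Set.univ f)
    (hf : Differentiable ℝ f) (x y : E) : f x + inner ℝ (∇ f x) (y - x) ≤ f y := by
  have hline : ConvexOn ℝ Set.univ (fun s : ℝ => f (x + s • (y - x))) := by
    refine ⟨convex_univ, fun a _ b _ α β hα hβ hαβ => ?_⟩
    have := hc.2 (Set.mem_univ (x + a • (y - x))) (Set.mem_univ (x + b • (y - x))) hα hβ hαβ
    have heq : α • (x + a • (y - x)) + β • (x + b • (y - x))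
        = x + (α • a + β • b) • (y - x) := by
      obtain rfl : β = 1 - α := by linarith
      simp only [smul_eq_mul]; module
    rwa [heq] at this
  have hd := hasDerivAt_line_gradient hf x (y - x) 0
  have := hline.le_slope_of_hasDerivAt (Set.mem_univ 0) (Set.mem_univ 1) one_pos hd
  simp only [slope_def_field, zero_smul, one_smul, add_zero, sub_zero, div_one,
    add_sub_cancel] at this
  linarith

/-- The descent lemma for functions with Lipschitz gradient. -/
theorem le_add_inner_gradient_add_sq {f : E → ℝ} {L : ℝ}
    (hf : Differentiable ℝ f) (hL : ∀ x y, ‖∇ f x - ∇ f y‖ ≤ L * ‖x - y‖) (x v : E) :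
    f (x + v) ≤ f x + inner ℝ (∇ f x) v + L / 2 * ‖v‖ ^ 2 := by
  -- Subtracting the quadratic model along the segment turns the claim into `h 1 ≤ h 0`;
  -- Cauchy-Schwarz and the Lipschitz bound make the derivative of `h` nonpositive.
  let h : ℝ → ℝ := fun s => f (x + s • v) - s * inner ℝ (∇ f x) v - s ^ 2 * (L / 2 * ‖v‖ ^ 2)
  have hd : ∀ t, HasDerivAt h
      (inner ℝ (∇ f (x + t • v)) v - inner ℝ (∇ f x) v - 2 * t * (L / 2 * ‖v‖ ^ 2)) t := by
    intro t
    have h1 := (hasDerivAt_id t).mul_const (inner ℝ (∇ f x) v)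
    have h2 := (hasDerivAt_pow 2 t).mul_const (L / 2 * ‖v‖ ^ 2)
    have := ((hasDerivAt_line_gradient hf x v t).sub h1).sub h2
    simpa only [h, id, one_mul, Nat.cast_ofNat, Nat.add_one_sub_one, pow_one] using! this
  have hanti : AntitoneOn h (Set.Icc 0 1) := by
    refine antitoneOn_of_deriv_nonpos (convex_Icc 0 1)
      (fun t _ => (hd t).continuousAt.continuousWithinAt)
      (fun t _ => (hd t).differentiableAt.differentiableWithinAt) fun t ht => ?_
    rw [interior_Icc] at ht
    rw [(hd t).deriv, ← inner_sub_left]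
    have h1 := real_inner_le_norm (∇ f (x + t • v) - ∇ f x) v
    have h2 := hL (x + t • v) x
    rw [add_sub_cancel_left, norm_smul, Real.norm_of_nonneg ht.1.le] at h2
    nlinarith [mul_le_mul_of_nonneg_right h2 (norm_nonneg v)]
  have := hanti (Set.left_mem_Icc.2 zero_le_one) (Set.right_mem_Icc.2 zero_le_one) zero_le_one
  simp only [h, zero_smul, one_smul, add_zero, zero_mul, one_mul, sub_zero, one_pow, ne_eq,
    OfNat.ofNat_ne_zero, not_false_eq_true, zero_pow] at this
  linarith

/-- The gradient of a convex function with `L`-Lipschitz gradient is `1/L`-cocoercive. -/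
theorem ConvexOn.norm_gradient_sub_sq_le {f : E → ℝ} {L : ℝ} (hc : ConvexOn ℝ Set.univ f)
    (hf : Differentiable ℝ f) (hL0 : 0 < L) (hL : ∀ x y, ‖∇ f x - ∇ f y‖ ≤ L * ‖x - y‖) (x y : E) :
    1 / L * ‖∇ f x - ∇ f y‖ ^ 2 ≤ inner ℝ (x - y) (∇ f x - ∇ f y) := by
  -- The step -(1/L)w from y minimizes the quadratic upper bound for f - ⟨∇f(x), ·⟩ given by the
  -- descent lemma, while convexity bounds the same function below by its value at x. Cocoercivity
  -- is the sum of this inequality and its copy with x and y exchanged.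
  have key : ∀ x y, f x + inner ℝ (∇ f x) (y - x) + 1 / (2 * L) * ‖∇ f y - ∇ f x‖ ^ 2 ≤ f y := by
    intro x y
    set w := ∇ f y - ∇ f x with hw
    have h1 := le_add_inner_gradient_add_sq hf hL y (-(1 / L) • w)
    have h2 := hc.add_inner_gradient_le hf x (y + -(1 / L) • w)
    have h3 : inner ℝ (∇ f x) (y + -(1 / L) • w - x)
        = inner ℝ (∇ f x) (y - x) - 1 / L * inner ℝ (∇ f x) w := by
      rw [show y + -(1 / L) • w - x = (y - x) - (1 / L) • w by module, inner_sub_right,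
        real_inner_smul_right]
    have h4 : inner ℝ (∇ f y) w - inner ℝ (∇ f x) w = ‖w‖ ^ 2 := by
      rw [← inner_sub_left, ← hw, real_inner_self_eq_norm_sq]
    rw [real_inner_smul_right, norm_smul, mul_pow, Real.norm_eq_abs, sq_abs] at h1
    have h5 : L / 2 * ((-(1 / L)) ^ 2 * ‖w‖ ^ 2) = 1 / (2 * L) * ‖w‖ ^ 2 := by field_simp
    have h6 : 1 / L * ‖w‖ ^ 2 = 2 * (1 / (2 * L) * ‖w‖ ^ 2) := by field_simp
    have h7 : 1 / L * inner ℝ (∇ f y) w = 1 / L * inner ℝ (∇ f x) w + 1 / L * ‖w‖ ^ 2 := by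
      rw [← h4]; ring
    linarith
  have h1 := key x y
  have h2 := key y x
  rw [norm_sub_rev] at h1
  have h3 : inner ℝ (x - y) (∇ f x - ∇ f y)
      = -inner ℝ (∇ f x) (y - x) - inner ℝ (∇ f y) (x - y) := by
    rw [real_inner_comm, inner_sub_left, ← neg_sub x y, inner_neg_right]; ring
  have h6 : 1 / L * ‖∇ f x - ∇ f y‖ ^ 2 = 2 * (1 / (2 * L) * ‖∇ f x - ∇ f y‖ ^ 2) := by field_simp
  linarith

end SmoothConvex

/-! ### Subgradients and the proximal operator -/

/-- Passing to the limit in a linear estimate with quadratic error along `t → 0`. -/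
theorem nonneg_of_forall_mul_add_sq {a b : ℝ} (h : ∀ t, 0 < t → t ≤ 1 → 0 ≤ t * a + t ^ 2 * b) :
    0 ≤ a := by
  have ht : Tendsto (fun t : ℝ => a + t * b) (𝓝[>] 0) (𝓝 a) := by
    have : Tendsto (fun t : ℝ => a + t * b) (𝓝 0) (𝓝 (a + 0 * b)) :=
      (continuous_const.add (continuous_id.mul continuous_const)).tendsto 0
    rw [zero_mul, add_zero] at this
    exact this.mono_left nhdsWithin_le_nhds
  refine ge_of_tendsto ht ?_
  filter_upwards [Ioc_mem_nhdsGT (zero_lt_one' ℝ)] with t ht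
  have := h t ht.1 ht.2
  exact (mul_nonneg_iff_of_pos_left ht.1).1 (by linarith)

namespace BasicMethod

variable {d : ℕ} {g : Primal d → EReal}

/-- The vector `s` is a subgradient of `g` at the point `q` of its domain. -/
def HasSubgradientAt (g : Primal d → EReal) (q s : Primal d) : Prop :=
  g q ≠ ⊤ ∧ ∀ u, g q + ((inner ℝ s (u - q) : ℝ) : EReal) ≤ g u

theorem IsConvexFun.le_combo (hg : IsConvexFun g) {x y : Primal d} {a b s t : ℝ}
    (hx : g x ≤ (a : EReal)) (hy : g y ≤ (b : EReal)) (hs : 0 ≤ s) (ht : 0 ≤ t) (hst : s + t = 1) :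
    g (s • x + t • y) ≤ ((s * a + t * b : ℝ) : EReal) := by
  have hx' : (x, a) ∈ {q : Primal d × ℝ | g q.1 ≤ (q.2 : EReal)} := hx
  have hy' : (y, b) ∈ {q : Primal d × ℝ | g q.1 ≤ (q.2 : EReal)} := hy
  simpa using hg hx' hy' hs ht hst

theorem IsProperFun.exists_coe (hg : IsProperFun g) {x : Primal d} (hx : g x ≠ ⊤) :
    ∃ r : ℝ, g x = r :=
  ⟨(g x).toReal, (EReal.coe_toReal hx (hg.1 x)).symm⟩

theorem IsProperFun.ne_top_of_isMin (hp : IsProperFun g) {h : Primal d → ℝ} {q : Primal d}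
    (hmin : ∀ u, g q + (h q : EReal) ≤ g u + (h u : EReal)) : g q ≠ ⊤ := by
  obtain ⟨x, hx⟩ := hp.2
  obtain ⟨r, hr⟩ := hp.exists_coe hx
  intro htop
  have := hmin x
  rw [htop, hr, EReal.top_add_coe, ← EReal.coe_add, top_le_iff] at this
  exact EReal.coe_ne_top _ this

/-- Necessary optimality condition for the minimization of `g + h`, with `h` smooth at `q`. -/
theorem hasSubgradientAt_of_isMin (hc : IsConvexFun g) (hp : IsProperFun g) {h : Primal d → ℝ}
    {q s : Primal d} {C : ℝ} (hmin : ∀ u, g q + (h q : EReal) ≤ g u + (h u : EReal))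
    (hh : ∀ w, h (q + w) ≤ h q + inner ℝ s w + C * ‖w‖ ^ 2) : HasSubgradientAt g q (-s) := by
  have hq := hp.ne_top_of_isMin hmin
  refine ⟨hq, fun u => ?_⟩
  by_cases hu : g u = ⊤
  · simp [hu]
  obtain ⟨a, ha⟩ := hp.exists_coe hq
  obtain ⟨b, hb⟩ := hp.exists_coe hu
  rw [ha, hb, ← EReal.coe_add, EReal.coe_le_coe_iff, inner_neg_left]
  suffices 0 ≤ b - a + inner ℝ s (u - q) by linarith
  -- Comparing q with the point at parameter t towards u, convexity of g and the bound on h give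
  -- terms of order t plus an error of order t².
  refine nonneg_of_forall_mul_add_sq (b := C * ‖u - q‖ ^ 2) fun t ht ht1 => ?_
  have h1 := hc.le_combo ha.le hb.le (sub_nonneg.2 ht1) ht.le (by ring)
  have h2 := hmin (q + t • (u - q))
  rw [show (1 - t) • q + t • u = q + t • (u - q) by module] at h1
  have h3 := h2.trans (add_le_add_left h1 _)
  rw [ha, ← EReal.coe_add, ← EReal.coe_add, EReal.coe_le_coe_iff] at h3
  have h4 := hh (t • (u - q))
  rw [real_inner_smul_right, norm_smul, mul_pow, Real.norm_eq_abs, sq_abs] at h4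
  linarith

/-- Sufficient optimality condition for the minimization of `g + h`, with `h` convex. -/
theorem HasSubgradientAt.isMin {h : Primal d → ℝ} {q s : Primal d}
    (hs : HasSubgradientAt g q (-s)) (hh : ∀ w, h q + inner ℝ s w ≤ h (q + w)) (u : Primal d) :
    g q + (h q : EReal) ≤ g u + (h u : EReal) := by
  refine le_trans ?_ (add_le_add_left (hs.2 u) _)
  rw [add_assoc, ← EReal.coe_add]
  refine add_le_add_right (EReal.coe_le_coe_iff.2 ?_) _
  have := hh (u - q)
  rw [add_sub_cancel] at this
  rw [inner_neg_left]
  linarith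

/-- Monotonicity of the subdifferential. -/
theorem HasSubgradientAt.inner_sub_nonneg (hp : IsProperFun g) {q s q' s' : Primal d}
    (h : HasSubgradientAt g q s) (h' : HasSubgradientAt g q' s') :
    0 ≤ inner ℝ (s - s') (q - q') := by
  obtain ⟨a, ha⟩ := hp.exists_coe h.1
  obtain ⟨b, hb⟩ := hp.exists_coe h'.1
  have h1 := h.2 q'
  have h2 := h'.2 q
  rw [ha, hb, ← EReal.coe_add, EReal.coe_le_coe_iff] at h1 h2
  rw [inner_sub_left]
  rw [← neg_sub q q', inner_neg_right] at h1
  linarith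

/-- A closed proper convex function has a minorant that decreases at most linearly. -/
theorem exists_linear_minorant (hc : IsConvexFun g) (hl : LowerSemicontinuous g)
    (hp : IsProperFun g) (x : Primal d) (hx : g x ≠ ⊤) :
    ∃ A B : ℝ, 0 ≤ B ∧ ∀ u, ((A - B * ‖u - x‖ : ℝ) : EReal) ≤ g u := by
  obtain ⟨r, hr⟩ := hp.exists_coe hx
  -- Let a be the minimum over the unit ball. For u outside, the segment from x to u meets the unit
  -- sphere at a point of value at least a, and convexity extrapolates this to g(u) ≥ a - (r - a)(n
  -- - 1) with n = ‖u - x‖.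
  obtain ⟨m, -, hm⟩ := LowerSemicontinuousOn.exists_isMinOn (s := Metric.closedBall x 1)
    ⟨x, Metric.mem_closedBall_self zero_le_one⟩ (isCompact_closedBall x 1) (hl.lowerSemicontinuousOn _)
  have hmx : g m ≤ g x := hm (Metric.mem_closedBall_self zero_le_one)
  obtain ⟨a, ha⟩ := hp.exists_coe (x := m) fun h => hx (top_le_iff.1 (h ▸ hmx))
  rw [ha, hr, EReal.coe_le_coe_iff] at hmx
  refine ⟨a, r - a, by linarith, fun u => ?_⟩
  rcases le_or_gt ‖u - x‖ 1 with hu | hu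
  · have : g m ≤ g u := hm (by simpa [dist_eq_norm] using hu)
    rw [ha] at this
    refine le_trans (EReal.coe_le_coe_iff.2 ?_) this
    nlinarith [norm_nonneg (u - x)]
  · by_cases hut : g u = ⊤
    · simp [hut]
    obtain ⟨b, hb⟩ := hp.exists_coe hut
    set n := ‖u - x‖ with hn
    have hn0 : 0 < n := by linarith
    have hin : 1 / n ≤ 1 := by rw [div_le_one hn0]; exact hu.le
    have h1 := hc.le_combo hr.le hb.le (sub_nonneg.2 hin) (one_div_nonneg.2 hn0.le) (by ring)
    have h2 : g m ≤ g ((1 - 1 / n) • x + (1 / n) • u) := by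
      refine hm ?_
      rw [Metric.mem_closedBall, dist_eq_norm,
        show (1 - 1 / n) • x + (1 / n) • u - x = (1 / n) • (u - x) by module, norm_smul,
        Real.norm_of_nonneg (by positivity), ← hn]
      field_simp; rfl
    have h3 := h2.trans h1
    rw [ha, EReal.coe_le_coe_iff] at h3
    rw [hb, EReal.coe_le_coe_iff]
    have h4 : a * n ≤ (n - 1) * r + b := by
      calc a * n ≤ ((1 - 1 / n) * r + 1 / n * b) * n := mul_le_mul_of_nonneg_right h3 hn0.le
        _ = (n - 1) * r + b := by field_simp
    nlinarith

/-- The quadratic term beats the linear minorant of g, so outside a large ball the objective exceeds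
its value at a domain point; a minimizer over the compact ball is then global. -/
theorem exists_prox_minimizer (hc : IsConvexFun g) (hl : LowerSemicontinuous g)
    (hp : IsProperFun g) {c : ℝ} (hc0 : 0 < c) (v : Primal d) :
    ∃ q : Primal d, ∀ u : Primal d, g q + ((c * ‖q - v‖ ^ 2 : ℝ) : EReal) ≤
        g u + ((c * ‖u - v‖ ^ 2 : ℝ) : EReal) := by
  obtain ⟨x, hx⟩ := hp.2
  obtain ⟨r, hr⟩ := hp.exists_coe hx
  obtain ⟨A, B, hB, hAB⟩ := exists_linear_minorant hc hl hp x hx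
  -- With n = ‖u - x‖ one has cn²/2 ≤ c‖u - v‖² + c‖x - v‖², so M + Bn ≤ cn²/2 suffices. This holds
  -- for n > R; the 1 in the maximum gives M ≤ |M|n.
  set M : ℝ := r + 2 * c * ‖x - v‖ ^ 2 - A with hM
  set R : ℝ := max 1 (2 * (B + |M|) / c) with hR
  have hφ : LowerSemicontinuous fun u => g u + ((c * ‖u - v‖ ^ 2 : ℝ) : EReal) := by
    refine hl.add' (Continuous.lowerSemicontinuous ?_) fun u => ?_
    · exact continuous_coe_real_ereal.comp (by fun_prop)
    · exact EReal.continuousAt_add (Or.inr (EReal.coe_ne_bot _)) (Or.inr (EReal.coe_ne_top _))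
  have hR0 : (0 : ℝ) ≤ R := le_trans zero_le_one (le_max_left _ _)
  obtain ⟨q, -, hq⟩ := LowerSemicontinuousOn.exists_isMinOn (s := Metric.closedBall x R)
    ⟨x, Metric.mem_closedBall_self hR0⟩ (isCompact_closedBall x R) (hφ.lowerSemicontinuousOn _)
  refine ⟨q, fun u => ?_⟩
  rcases le_or_gt ‖u - x‖ R with hu | hu
  · exact hq (by simpa [dist_eq_norm] using hu)
  · refine le_trans (hq (Metric.mem_closedBall_self hR0)) ?_
    refine le_trans ?_ (add_le_add_left (hAB u) _)
    simp only [hr]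
    rw [← EReal.coe_add, ← EReal.coe_add, EReal.coe_le_coe_iff]
    set n := ‖u - x‖
    have h1 : 1 ≤ n := (le_max_left _ _).trans hu.le
    have h2 : 2 * (B + |M|) ≤ n * c := (div_le_iff₀ hc0).1 ((le_max_right _ _).trans hu.le)
    have h3 : n ≤ ‖u - v‖ + ‖x - v‖ := by
      have := norm_sub_le (u - v) (x - v)
      rwa [sub_sub_sub_cancel_right] at this
    have h4 : n ^ 2 ≤ 2 * ‖u - v‖ ^ 2 + 2 * ‖x - v‖ ^ 2 := by
      nlinarith [sq_nonneg (‖u - v‖ - ‖x - v‖)]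
    have h5 : M ≤ |M| * n := (le_abs_self M).trans (le_mul_of_one_le_right (abs_nonneg M) h1)
    nlinarith [mul_le_mul_of_nonneg_left h4 hc0.le, mul_le_mul_of_nonneg_left h2 (zero_le_one.trans h1)]

/-- Characterization of the proximal point by its subgradient. -/
theorem prox_eq_iff (hc : IsConvexFun g) (hl : LowerSemicontinuous g) (hp : IsProperFun g)
    {lam : ℝ} (hlam : 0 < lam) (v q : Primal d) :
    prox lam g v = q ↔ HasSubgradientAt g q ((1 / lam) • (v - q)) := by
  have hprox : HasSubgradientAt g (prox lam g v) ((1 / lam) • (v - prox lam g v)) := by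
    have hex := exists_prox_minimizer hc hl hp (c := 1 / (2 * lam)) (by positivity) v
    have hspec : ∀ u, g (prox lam g v) + ((1 / (2 * lam) * ‖prox lam g v - v‖ ^ 2 : ℝ) : EReal) ≤
        g u + ((1 / (2 * lam) * ‖u - v‖ ^ 2 : ℝ) : EReal) := by
      rw [prox, dif_pos hex]; exact hex.choose_spec
    rw [show (1 / lam) • (v - prox lam g v) = -((1 / lam) • (prox lam g v - v)) by module]
    refine hasSubgradientAt_of_isMin hc hp (h := fun u => 1 / (2 * lam) * ‖u - v‖ ^ 2)
      (C := 1 / (2 * lam)) hspec fun w => le_of_eq ?_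
    rw [add_sub_right_comm, norm_add_sq_real, real_inner_smul_left]
    field_simp
  refine ⟨fun h => h ▸ hprox, fun h => ?_⟩
  -- Uniqueness: for two candidates, monotonicity gives -(1/λ) times their squared distance as a
  -- nonnegative number.
  have h1 := hprox.inner_sub_nonneg hp h
  rw [← smul_sub, sub_sub_sub_cancel_left, real_inner_smul_left, ← neg_sub, inner_neg_left,
    real_inner_self_eq_norm_sq] at h1
  have h2 : ‖prox lam g v - q‖ ^ 2 ≤ 0 := by
    by_contra! h3
    have : 0 < 1 / lam * ‖prox lam g v - q‖ ^ 2 := by positivity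
    linarith
  have h3 : ‖prox lam g v - q‖ = 0 := by
    exact pow_eq_zero_iff two_ne_zero |>.1 (le_antisymm h2 (sq_nonneg _))
  exact sub_eq_zero.1 (norm_eq_zero.1 h3)

/-- Firm nonexpansiveness of the proximal operator. -/
theorem prox_firmly_nonexpansive (hc : IsConvexFun g) (hl : LowerSemicontinuous g)
    (hp : IsProperFun g) {lam : ℝ} (hlam : 0 < lam) (v w : Primal d) :
    ‖prox lam g v - prox lam g w‖ ^ 2 ≤
      ‖v - w‖ ^ 2 - ‖prox lam g v - v - (prox lam g w - w)‖ ^ 2 := by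
  have h1 := ((prox_eq_iff hc hl hp hlam v _).1 rfl).inner_sub_nonneg hp
    ((prox_eq_iff hc hl hp hlam w _).1 rfl)
  generalize prox lam g v = a at *
  generalize prox lam g w = b at *
  rw [← smul_sub, real_inner_smul_left] at h1
  have h2 : 0 ≤ inner ℝ (v - a - (w - b)) (a - b) :=
    (mul_nonneg_iff_of_pos_left (by positivity)).1 h1
  rw [show v - w = (v - a - (w - b)) + (a - b) by abel, norm_add_sq_real,
    show a - v - (b - w) = -(v - a - (w - b)) by abel, norm_neg]
  linarith

theorem prox_lipschitz (hc : IsConvexFun g) (hl : LowerSemicontinuous g)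
    (hp : IsProperFun g) {lam : ℝ} (hlam : 0 < lam) : LipschitzWith 1 (prox lam g) := by
  refine LipschitzWith.of_dist_le_mul fun v w => ?_
  rw [dist_eq_norm, dist_eq_norm, NNReal.coe_one, one_mul]
  refine (pow_le_pow_iff_left₀ (norm_nonneg _) (norm_nonneg _) two_ne_zero).1 ?_
  have := prox_firmly_nonexpansive hc hl hp hlam v w
  nlinarith [sq_nonneg ‖prox lam g v - v - (prox lam g w - w)‖]

end BasicMethod

/-! ### The one-step estimate -/

/-- Second moment bound for `A_j - B_j + b`, where `b` is the mean of the `B_j`. -/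
theorem sum_mul_norm_sub_add_mean_sq_le {E ι : Type*} [NormedAddCommGroup E]
    [InnerProductSpace ℝ E] [Fintype ι] {p : ι → ℝ} (hp : ∀ j, 0 ≤ p j) (hp1 : ∑ j, p j = 1)
    (A B : ι → E) {a b : E} (ha : ∑ j, p j • A j = a) (hb : ∑ j, p j • B j = b) :
    ∑ j, p j * ‖A j - B j + b‖ ^ 2 ≤
      2 * ∑ j, p j * ‖A j‖ ^ 2 + 2 * ∑ j, p j * ‖B j‖ ^ 2 - ‖a‖ ^ 2 - 2 * ‖b‖ ^ 2 := by
  have hpt : ∀ j, ‖A j - B j + b‖ ^ 2 ≤ 2 * ‖A j‖ ^ 2 + 2 * ‖B j‖ ^ 2 + ‖a‖ ^ 2 + 2 * ‖b‖ ^ 2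
      + 2 * inner ℝ a b - 2 * inner ℝ a (A j) - 2 * inner ℝ a (B j) - 4 * inner ℝ b (B j) := by
    intro j
    -- This square is exactly the gap in the inequality. The linear terms were kept so that
    -- averaging replaces A_j and B_j by their means.
    have h := sq_nonneg ‖(A j - a) + (B j - b)‖
    simp only [← real_inner_self_eq_norm_sq, inner_add_left, inner_add_right, inner_sub_left,
      inner_sub_right] at h ⊢
    rw [real_inner_comm a (A j), real_inner_comm b (B j), real_inner_comm (B j) (A j),
      real_inner_comm b (A j), real_inner_comm a (B j), real_inner_comm a b] at *
    linarith
  have hin : ∀ (c : E) (X : ι → E), ∑ j, p j * inner ℝ c (X j) = inner ℝ c (∑ j, p j • X j) := by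
    intro c X
    simp [inner_sum, real_inner_smul_right]
  have hsum := Finset.sum_le_sum fun j (_ : j ∈ Finset.univ) =>
    mul_le_mul_of_nonneg_left (hpt j) (hp j)
  refine hsum.trans (le_of_eq ?_)
  have expand : ∀ j, p j * (2 * ‖A j‖ ^ 2 + 2 * ‖B j‖ ^ 2 + ‖a‖ ^ 2 + 2 * ‖b‖ ^ 2
      + 2 * inner ℝ a b - 2 * inner ℝ a (A j) - 2 * inner ℝ a (B j) - 4 * inner ℝ b (B j))
      = 2 * (p j * ‖A j‖ ^ 2) + 2 * (p j * ‖B j‖ ^ 2)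
        + p j * (‖a‖ ^ 2 + 2 * ‖b‖ ^ 2 + 2 * inner ℝ a b) - 2 * (p j * inner ℝ a (A j))
        - 2 * (p j * inner ℝ a (B j)) - 4 * (p j * inner ℝ b (B j)) := fun j => by ring
  simp only [expand, Finset.sum_sub_distrib, Finset.sum_add_distrib, ← Finset.mul_sum,
    ← Finset.sum_mul, hin, hp1, ha, hb, real_inner_self_eq_norm_sq]
  ring

namespace BasicMethod

variable {d N : ℕ} {f : Fin N → Primal d → ℝ} {L : Fin N → ℝ} {g : Primal d → EReal} {lam : ℝ}
  {p ρ : Fin N → ℝ}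

@[simp] theorem dual_mkPoint (x : Primal d) (y : Fin N → Primal d) (i : Fin N) :
    dual (mkPoint x y) i = y i := rfl

@[simp] theorem primal_sub (z w : PrimalDual d N) : primal (z - w) = primal z - primal w := rfl

@[simp] theorem dual_sub (z w : PrimalDual d N) (i : Fin N) :
    dual (z - w) i = dual z i - dual w i := rfl

theorem mkPoint_eq_zero_iff (x : Primal d) (y : Fin N → Primal d) :
    mkPoint x y = 0 ↔ x = 0 ∧ ∀ i, y i = 0 := by
  refine ⟨fun h => ⟨congrArg primal h, fun i => congrArg (fun z => dual z i) h⟩, ?_⟩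
  rintro ⟨rfl, hy⟩
  obtain rfl : y = 0 := funext hy
  rfl

theorem norm_sq_eq (z : PrimalDual d N) :
    ‖z‖ ^ 2 = ‖primal z‖ ^ 2 + ∑ i, ‖dual z i‖ ^ 2 := by
  exact (WithLp.prod_norm_sq_eq_of_L2 z).trans
    (congrArg (‖primal z‖ ^ 2 + ·) (PiLp.norm_sq_eq_of_L2 _ z.snd))

theorem inner_gammaOp (lam : ℝ) (ρ L : Fin N → ℝ) (z : PrimalDual d N) :
    inner ℝ z (gammaOp lam ρ L z)
      = ‖primal z‖ ^ 2 + ∑ i, lam / ((N : ℝ) * ρ i * L i) * ‖dual z i‖ ^ 2 := by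
  rw [WithLp.prod_inner_apply, PiLp.inner_apply, ← real_inner_self_eq_norm_sq]
  congr 1
  refine Finset.sum_congr rfl fun i _ => ?_
  rw [← real_inner_self_eq_norm_sq, ← real_inner_smul_right]
  rfl

theorem weight_nonneg (hlam : 0 < lam) (hρ : ∀ i, 0 < ρ i) (hL : ∀ i, 0 < L i) (i : Fin N) :
    0 ≤ lam / ((N : ℝ) * ρ i * L i) := by
  have := hρ i
  have := hL i
  positivity

theorem gammaNorm_sq (hlam : 0 < lam) (hρ : ∀ i, 0 < ρ i) (hL : ∀ i, 0 < L i)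
    (z : PrimalDual d N) : gammaNorm lam ρ L z ^ 2
      = ‖primal z‖ ^ 2 + ∑ i, lam / ((N : ℝ) * ρ i * L i) * ‖dual z i‖ ^ 2 := by
  rw [gammaNorm, Real.sq_sqrt, inner_gammaOp]
  rw [inner_gammaOp]
  exact add_nonneg (sq_nonneg _) (Finset.sum_nonneg fun i _ =>
    mul_nonneg (weight_nonneg hlam hρ hL i) (sq_nonneg _))

theorem gradient_avg (hf : ∀ i, Differentiable ℝ (f i)) (x : Primal d) :
    ∇ (avg f) x = (1 / (N : ℝ)) • ∑ i, ∇ (f i) x := by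
  refine HasGradientAt.gradient ?_
  rw [hasGradientAt_iff_hasFDerivAt, map_smul, map_sum]
  have := (HasFDerivAt.fun_sum fun i (_ : i ∈ Finset.univ) =>
    (hf i x).hasGradientAt.hasFDerivAt).const_mul (1 / (N : ℝ))
  exact this

theorem ProblemAssumptions.differentiable (h : ProblemAssumptions f L g) (i : Fin N) :
    Differentiable ℝ (f i) := (h.smooth_f i).1

theorem ProblemAssumptions.lipschitz (h : ProblemAssumptions f L g) (i : Fin N) :
    LipschitzWith (Real.toNNReal (L i)) (∇ (f i)) := by
  refine LipschitzWith.of_dist_le_mul fun x y => ?_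
  rw [dist_eq_norm, dist_eq_norm, Real.coe_toNNReal _ (h.L_pos i).le]
  exact (h.smooth_f i).2 x y

theorem inner_gradient_avg (hf : ∀ i, Differentiable ℝ (f i)) (x w : Primal d) :
    inner ℝ (∇ (avg f) x) w = (1 / (N : ℝ)) * ∑ i, inner ℝ (∇ (f i) x) w := by
  rw [gradient_avg hf, real_inner_smul_left, sum_inner]

/-- Solutions are characterized by the inclusion `-∇ F(x) ∈ ∂ g(x)`. -/
theorem mem_solutionSet_iff (h : ProblemAssumptions f L g) (x : Primal d) :
    x ∈ solutionSet f g ↔ HasSubgradientAt g x (-∇ (avg f) x) := by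
  have hN : (0 : ℝ) ≤ 1 / (N : ℝ) := by positivity
  constructor
  · intro hx
    refine hasSubgradientAt_of_isMin h.convex_g h.proper_g (h := avg f)
      (C := (1 / (N : ℝ)) * ∑ i, L i / 2) (fun u => ?_) fun w => ?_
    · rw [add_comm, add_comm (g u)]; exact hx u
    · rw [inner_gradient_avg h.differentiable, avg, avg, ← mul_add, mul_assoc, Finset.sum_mul,
        ← mul_add, ← Finset.sum_add_distrib, ← Finset.sum_add_distrib]
      exact mul_le_mul_of_nonneg_left (Finset.sum_le_sum fun i _ =>
        le_add_inner_gradient_add_sq (h.differentiable i) (h.smooth_f i).2 x w) hN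
  · intro hx u
    rw [add_comm, add_comm _ (g u)]
    refine hx.isMin (h := avg f) (fun w => ?_) u
    rw [inner_gradient_avg h.differentiable, avg, avg, ← mul_add, ← Finset.sum_add_distrib]
    refine mul_le_mul_of_nonneg_left (Finset.sum_le_sum fun i _ => ?_) hN
    simpa using (h.convex_f i).add_inner_gradient_le (h.differentiable i) x (x + w)

/-- When the dual blocks are gradients at x, their mean is ∇F(x), and the primal block becomes the
forward-backward fixed-point equation. -/
theorem mem_zer_iff_prox (h : ProblemAssumptions f L g) (z : PrimalDual d N) :
    z ∈ zer f g lam ↔ prox lam g (primal z - lam • ∇ (avg f) (primal z)) = primal z ∧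
      ∀ i, dual z i = ∇ (f i) (primal z) := by
  rw [zer, Set.mem_ofPred_eq, residual, mkPoint_eq_zero_iff]
  simp only [sub_eq_zero]
  refine and_congr_left fun hy => ?_
  rw [gradient_avg h.differentiable, smul_smul, mul_one_div, ← Finset.sum_congr rfl fun i _ => hy i]
  exact eq_comm

theorem mem_zer_iff (h : ProblemAssumptions f L g) (hlam : 0 < lam) (z : PrimalDual d N) :
    z ∈ zer f g lam ↔ primal z ∈ solutionSet f g ∧ ∀ i, dual z i = ∇ (f i) (primal z) := by
  rw [mem_zer_iff_prox h, mem_solutionSet_iff h,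
    prox_eq_iff h.convex_g h.closed_g h.proper_g hlam]
  rw [show (1 / lam) • (primal z - lam • ∇ (avg f) (primal z) - primal z)
    = -∇ (avg f) (primal z) by
      rw [sub_sub_cancel_left, smul_neg, smul_smul, one_div_mul_cancel hlam.ne', one_smul]]

theorem zer_nonempty (h : ProblemAssumptions f L g) (hlam : 0 < lam) :
    (zer f g lam).Nonempty := by
  obtain ⟨x, hx⟩ := h.solvable
  exact ⟨mkPoint x fun i => ∇ (f i) x, (mem_zer_iff h hlam _).2 ⟨hx, fun i => rfl⟩⟩

/-- The squared distance of the forward step with sampled index `j` to the forward step at a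
solution. -/
noncomputable def forwardSq (f : Fin N → Primal d → ℝ) (lam : ℝ) (p : Fin N → ℝ) (zs : PrimalDual d N)
    (j : Fin N) (z : PrimalDual d N) : ℝ :=
  ‖primal z - lam • stochGrad f p j z - (primal zs - lam • ∇ (avg f) (primal zs))‖ ^ 2

/-- The value of the primal increment of the step from `z` with sampled index `j`. -/
noncomputable def stepIncrement (f : Fin N → Primal d → ℝ) (g : Primal d → EReal) (lam : ℝ) (p : Fin N → ℝ)
    (zs : PrimalDual d N) (j : Fin N) (z : PrimalDual d N) : ℝ :=
  ‖prox lam g (primal z - lam • stochGrad f p j z) - primal z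
    + lam • (stochGrad f p j z - ∇ (avg f) (primal zs))‖ ^ 2

/-- The part of `ζ_k` that is determined by the current iterate. -/
noncomputable def decrease (f : Fin N → Primal d → ℝ) (L : Fin N → ℝ) (lam : ℝ) (p : Fin N → ℝ)
    (zs z : PrimalDual d N) : ℝ :=
  (∑ i, lam / (N : ℝ) * (1 / L i - 2 * lam / ((N : ℝ) * p i)) *
      (‖∇ (f i) (primal z) - ∇ (f i) (primal zs)‖ ^ 2 + ‖dual z i - dual zs i‖ ^ 2))
    + 2 * lam ^ 2 / (N : ℝ) ^ 2 * ‖∑ i, (dual z i - dual zs i)‖ ^ 2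
    + lam ^ 2 * ‖∇ (avg f) (primal z) - ∇ (avg f) (primal zs)‖ ^ 2

/-- Estimate of one step of the method for each outcome of the sampling. -/
theorem gammaNorm_step_sub_sq_le (h : ProblemAssumptions f L g) (hlam : 0 < lam)
    (hρ : ∀ i, 0 < ρ i) {zs : PrimalDual d N} (hzs : zs ∈ zer f g lam) (j : Fin N)
    {e : Fin N → ℝ} (he : ∀ i, e i = 0 ∨ e i = 1) (z : PrimalDual d N) :
    gammaNorm lam ρ L (step f g lam p j e z - zs) ^ 2 ≤
      forwardSq f lam p zs j z - stepIncrement f g lam p zs j z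
      + ∑ i, lam / ((N : ℝ) * ρ i * L i) * (‖dual z i - dual zs i‖ ^ 2
        + e i * (‖∇ (f i) (primal z) - ∇ (f i) (primal zs)‖ ^ 2 - ‖dual z i - dual zs i‖ ^ 2)) := by
  rw [gammaNorm_sq hlam hρ h.L_pos]
  obtain ⟨hx, hy⟩ := (mem_zer_iff_prox h zs).1 hzs
  refine add_le_add ?_ (le_of_eq (Finset.sum_congr rfl fun i _ => ?_))
  · have := prox_firmly_nonexpansive h.convex_g h.closed_g h.proper_g hlam
      (primal z - lam • stochGrad f p j z) (primal zs - lam • ∇ (avg f) (primal zs))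
    rw [hx] at this
    refine this.trans (le_of_eq ?_)
    rw [forwardSq, stepIncrement]
    congr 3
    module
  · congr 1
    simp only [step, dual_sub, dual_mkPoint]
    -- Because `e i` is 0 or 1, the squared dual distance is affine in it, so its conditional mean
    -- will need only ρ_i.
    rcases he i with h0 | h1
    · simp [h0]
    · simp [h1, hy i]

/-- The averaged one-step estimate. -/
theorem expected_step_le (h : ProblemAssumptions f L g) (hlam : 0 < lam) (hp : ∀ i, 0 < p i)
    (hp1 : ∑ i, p i = 1) (hρ : ∀ i, 0 < ρ i) {zs : PrimalDual d N} (hzs : zs ∈ zer f g lam)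
    (z : PrimalDual d N) :
    ∑ j, p j * forwardSq f lam p zs j z
      + ∑ i, lam / ((N : ℝ) * ρ i * L i) * (‖dual z i - dual zs i‖ ^ 2
        + ρ i * (‖∇ (f i) (primal z) - ∇ (f i) (primal zs)‖ ^ 2 - ‖dual z i - dual zs i‖ ^ 2))
      ≤ gammaNorm lam ρ L (z - zs) ^ 2 - decrease f L lam p zs z := by
  obtain ⟨-, hy⟩ := (mem_zer_iff_prox h zs).1 hzs
  have hN : (N : ℝ) ≠ 0 := by
    rintro hN
    obtain rfl : N = 0 := by exact_mod_cast hN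
    simp at hp1
  set x := primal z - primal zs with hxdef
  set a : Fin N → Primal d := fun i => ∇ (f i) (primal z) - ∇ (f i) (primal zs) with ha
  set b : Fin N → Primal d := fun i => dual z i - dual zs i with hb
  set A : Fin N → Primal d := fun i => (1 / ((N : ℝ) * p i)) • a i with hA
  set B : Fin N → Primal d := fun i => (1 / ((N : ℝ) * p i)) • b i with hB
  set am : Primal d := (1 / (N : ℝ)) • ∑ i, a i with ham
  set bm : Primal d := (1 / (N : ℝ)) • ∑ i, b i with hbm
  have hmean : ∀ c : Fin N → Primal d,
      ∑ j, p j • (1 / ((N : ℝ) * p j)) • c j = (1 / (N : ℝ)) • ∑ j, c j := by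
    intro c
    rw [Finset.smul_sum]
    refine Finset.sum_congr rfl fun j _ => ?_
    have := (hp j).ne'
    rw [smul_smul]; congr 1; field_simp
  have hsq : ∀ c : Fin N → Primal d, ∀ j,
      p j * ‖(1 / ((N : ℝ) * p j)) • c j‖ ^ 2 = 1 / ((N : ℝ) ^ 2 * p j) * ‖c j‖ ^ 2 := by
    intro c j
    have := (hp j).ne'
    rw [norm_smul, mul_pow, Real.norm_eq_abs, sq_abs]
    field_simp
  have hgrad : ∇ (avg f) (primal z) - ∇ (avg f) (primal zs) = am := by
    rw [gradient_avg h.differentiable, gradient_avg h.differentiable, ← smul_sub,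
      ← Finset.sum_sub_distrib]
  -- At a zero ∇F(x*) is the mean of the y_i*, so the estimator error splits into
  -- importance-weighted differences.
  have hfwd : ∀ j, forwardSq f lam p zs j z = ‖x - lam • (A j - B j + bm)‖ ^ 2 := by
    intro j
    have : stochGrad f p j z - ∇ (avg f) (primal zs) = A j - B j + bm := by
      rw [gradient_avg h.differentiable, stochGrad, ← Finset.sum_congr rfl fun i _ => hy i, hbm,
        hA, hB, ← smul_sub, ha, hb, Finset.sum_sub_distrib, smul_sub]
      simp only [hy j]
      module
    rw [forwardSq, ← this, hxdef]
    congr 2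
    module
  have hvar := sum_mul_norm_sub_add_mean_sq_le (fun j => (hp j).le) hp1 A B (hmean a) (hmean b)
  have hprim : ∑ j, p j * forwardSq f lam p zs j z
      = ‖x‖ ^ 2 - 2 * lam * inner ℝ x am + lam ^ 2 * ∑ j, p j * ‖A j - B j + bm‖ ^ 2 := by
    have hlin : ∑ j, p j * inner ℝ x (A j - B j + bm) = inner ℝ x am := by
      have : ∑ j, p j • (A j - B j + bm) = am := by
        simp only [smul_add, smul_sub, Finset.sum_add_distrib, Finset.sum_sub_distrib,
          ← Finset.sum_smul, hp1, one_smul]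
        rw [hmean a, hmean b, sub_add_cancel]
      rw [← this, inner_sum]
      exact Finset.sum_congr rfl fun j _ => (real_inner_smul_right _ _ _).symm
    have hexp : ∀ j, p j * forwardSq f lam p zs j z = p j * ‖x‖ ^ 2
        - 2 * lam * (p j * inner ℝ x (A j - B j + bm))
        + lam ^ 2 * (p j * ‖A j - B j + bm‖ ^ 2) := by
      intro j
      rw [hfwd, norm_sub_sq_real, real_inner_smul_right, norm_smul, mul_pow, Real.norm_eq_abs,
        sq_abs]
      ring
    simp only [hexp, Finset.sum_add_distrib, Finset.sum_sub_distrib, ← Finset.mul_sum,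
      ← Finset.sum_mul, hp1, one_mul, hlin]
  have hcoco : 1 / (N : ℝ) * ∑ i, 1 / L i * ‖a i‖ ^ 2 ≤ inner ℝ x am := by
    rw [ham, real_inner_smul_right, inner_sum]
    exact mul_le_mul_of_nonneg_left (Finset.sum_le_sum fun i _ =>
      (h.convex_f i).norm_gradient_sub_sq_le (h.differentiable i) (h.L_pos i) (h.smooth_f i).2 _ _)
      (by positivity)
  -- The factor ρ_i in the weight cancels the probability of a dual update.
  have hdual : ∑ i, lam / ((N : ℝ) * ρ i * L i) * (‖b i‖ ^ 2 + ρ i * (‖a i‖ ^ 2 - ‖b i‖ ^ 2))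
      = ∑ i, lam / ((N : ℝ) * ρ i * L i) * ‖b i‖ ^ 2
        + lam / N * ∑ i, 1 / L i * ‖a i‖ ^ 2 - lam / N * ∑ i, 1 / L i * ‖b i‖ ^ 2 := by
    rw [Finset.mul_sum, Finset.mul_sum, ← Finset.sum_add_distrib, ← Finset.sum_sub_distrib]
    refine Finset.sum_congr rfl fun i _ => ?_
    have := (hρ i).ne'
    have := (h.L_pos i).ne'
    field_simp
    ring
  have hdec : decrease f L lam p zs z = lam / N * ∑ i, 1 / L i * ‖a i‖ ^ 2
      + lam / N * ∑ i, 1 / L i * ‖b i‖ ^ 2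
      - 2 * lam ^ 2 * ∑ i, 1 / ((N : ℝ) ^ 2 * p i) * ‖a i‖ ^ 2
      - 2 * lam ^ 2 * ∑ i, 1 / ((N : ℝ) ^ 2 * p i) * ‖b i‖ ^ 2
      + 2 * lam ^ 2 * ‖bm‖ ^ 2 + lam ^ 2 * ‖am‖ ^ 2 := by
    rw [decrease, hgrad]
    congr 2
    · simp only [Finset.mul_sum]
      rw [← Finset.sum_add_distrib, ← Finset.sum_sub_distrib, ← Finset.sum_sub_distrib]
      refine Finset.sum_congr rfl fun i _ => ?_
      have := (hp i).ne'
      have := (h.L_pos i).ne'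
      field_simp
      ring
    · rw [hbm, norm_smul, mul_pow, Real.norm_eq_abs, sq_abs]
      field_simp
      rfl
  rw [gammaNorm_sq hlam hρ h.L_pos, hdec, hprim]
  simp only [primal_sub, dual_sub]
  change _ + ∑ i, lam / ((N : ℝ) * ρ i * L i) * (‖b i‖ ^ 2 + ρ i * (‖a i‖ ^ 2 - ‖b i‖ ^ 2)) ≤
    ‖x‖ ^ 2 + ∑ i, lam / ((N : ℝ) * ρ i * L i) * ‖b i‖ ^ 2 - _
  rw [hdual]
  have hvA : ∑ j, p j * ‖A j‖ ^ 2 = ∑ i, 1 / ((N : ℝ) ^ 2 * p i) * ‖a i‖ ^ 2 :=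
    Finset.sum_congr rfl fun j _ => hsq a j
  have hvB : ∑ j, p j * ‖B j‖ ^ 2 = ∑ i, 1 / ((N : ℝ) ^ 2 * p i) * ‖b i‖ ^ 2 :=
    Finset.sum_congr rfl fun j _ => hsq b j
  rw [hvA, hvB] at hvar
  have hvar' := mul_le_mul_of_nonneg_left hvar (sq_nonneg lam)
  have hcoco' := mul_le_mul_of_nonneg_left hcoco (mul_nonneg zero_le_two hlam.le)
  -- Of these two copies, one pays for the a_i terms of `hdual`, the other appears in `decrease`.
  have hc : 2 * lam * (1 / (N : ℝ) * ∑ i, 1 / L i * ‖a i‖ ^ 2)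
      = 2 * (lam / N * ∑ i, 1 / L i * ‖a i‖ ^ 2) := by ring
  linarith

end BasicMethod

/-! ### Integrability and conditional expectation under finite sampling -/

section Sampling

variable {Ω : Type*} {m mΩ : MeasurableSpace Ω} {μ : Measure Ω}

/-- A function selected by a finite-valued index is a sum of functions multiplied by indicators. -/
theorem eq_sum_indicator_mul {ι : Type*} [Fintype ι] (J : Ω → ι) (F : ι → Ω → ℝ) :
    (fun ω => F (J ω) ω)
      = ∑ j, {ω | J ω = j}.indicator (fun _ => (1 : ℝ)) * F j := by
  classical
  funext ω
  simp [Finset.sum_apply, Set.indicator_apply]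

theorem MeasureTheory.Integrable.indicator_one_mul {s : Set Ω} (hs : MeasurableSet s) {F : Ω → ℝ}
    (hF : Integrable F μ) : Integrable (s.indicator (fun _ => (1 : ℝ)) * F) μ := by
  have : s.indicator (fun _ => (1 : ℝ)) * F = s.indicator F := by
    funext ω
    by_cases h : ω ∈ s <;> simp [h]
  rw [this]
  exact hF.indicator hs

theorem MeasureTheory.Integrable.finite_choice {ι : Type*} [Fintype ι] {J : Ω → ι}
    (hJ : ∀ j, MeasurableSet {ω | J ω = j}) {F : ι → Ω → ℝ} (hF : ∀ j, Integrable (F j) μ) :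
    Integrable (fun ω => F (J ω) ω) μ := by
  rw [eq_sum_indicator_mul]
  exact integrable_finsetSum' _ fun j _ => (hF j).indicator_one_mul (hJ j)

/-- The `m`-measurable factor is pulled out, leaving the conditional probability of `s`. -/
theorem MeasureTheory.condExp_indicator_one_mul [IsFiniteMeasure μ] {s : Set Ω}
    (hs : MeasurableSet s) {c : ℝ} (hc : μ⟦s | m⟧ =ᵐ[μ] fun _ => c) {F : Ω → ℝ}
    (hFm : StronglyMeasurable[m] F) (hF : Integrable F μ) :
    μ[s.indicator (fun _ => (1 : ℝ)) * F | m] =ᵐ[μ] fun ω => c * F ω := by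
  refine (condExp_mul_of_stronglyMeasurable_right hFm (hF.indicator_one_mul hs)
    ((integrable_const 1).indicator hs)).trans ?_
  filter_upwards [hc] with ω hω
  rw [Pi.mul_apply, hω]

/-- Conditional expectation of a function selected by a random index with prescribed conditional
law. -/
theorem MeasureTheory.condExp_finite_choice [IsFiniteMeasure μ] {ι : Type*} [Fintype ι] {J : Ω → ι}
    (hJ : ∀ j, MeasurableSet {ω | J ω = j}) {p : ι → ℝ}
    (hp : ∀ j, μ⟦{ω | J ω = j} | m⟧ =ᵐ[μ] fun _ => p j) {F : ι → Ω → ℝ}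
    (hFm : ∀ j, StronglyMeasurable[m] (F j)) (hF : ∀ j, Integrable (F j) μ) :
    μ[fun ω => F (J ω) ω | m] =ᵐ[μ] fun ω => ∑ j, p j * F j ω := by
  rw [eq_sum_indicator_mul]
  refine (condExp_finsetSum (fun j _ => (hF j).indicator_one_mul (hJ j)) m).trans ?_
  have : ∀ᵐ ω ∂μ, ∀ j, (μ[{ω | J ω = j}.indicator (fun _ => (1 : ℝ)) * F j | m]) ω = p j * F j ω :=
    ae_all_iff.2 fun j => condExp_indicator_one_mul (hJ j) (hp j) (hFm j) (hF j)
  filter_upwards [this] with ω hω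
  rw [Finset.sum_apply]
  exact Finset.sum_congr rfl fun j _ => hω j

end Sampling

/-- After subtracting `g 0` the map fixes the origin and grows at most linearly; the constant added
back is in every L^p as the measure is finite. -/
theorem LipschitzWith.comp_memLp_of_isFiniteMeasure {α E F : Type*} {K : NNReal}
    [MeasurableSpace α] {μ : Measure α} [IsFiniteMeasure μ] [NormedAddCommGroup E]
    [NormedAddCommGroup F] {p : ENNReal} {f : α → E} {g : E → F} (hg : LipschitzWith K g)
    (hf : MemLp f p μ) : MemLp (fun a => g (f a)) p μ := by
  have h1 : LipschitzWith K fun x => g x - g 0 :=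
    LipschitzWith.of_dist_le_mul fun x y => by simpa using hg.dist_le_mul x y
  have h2 := (h1.comp_memLp (sub_self _) hf).add (memLp_const (g 0))
  refine h2.ae_eq (Eventually.of_forall fun a => ?_)
  simp

/-! ### Continuity, measurability and second moments -/

namespace BasicMethod

variable {d N : ℕ} {f : Fin N → Primal d → ℝ} {L : Fin N → ℝ} {g : Primal d → EReal} {lam : ℝ}
  {p ρ : Fin N → ℝ}

@[fun_prop] theorem continuous_primal : Continuous (primal : PrimalDual d N → Primal d) :=
  WithLp.continuous_fst ..

@[fun_prop] theorem continuous_dual (i : Fin N) :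
    Continuous fun z : PrimalDual d N => dual z i :=
  (PiLp.continuous_apply 2 _ i).comp (WithLp.continuous_snd ..)

theorem continuous_mkPoint {X : Type*} [TopologicalSpace X] {x : X → Primal d}
    {y : Fin N → X → Primal d} (hx : Continuous x) (hy : ∀ i, Continuous (y i)) :
    Continuous fun a => mkPoint (x a) fun i => y i a :=
  (WithLp.prod_continuous_toLp ..).comp
    (hx.prodMk ((PiLp.continuous_toLp ..).comp (continuous_pi hy)))

theorem norm_primal_le (z : PrimalDual d N) : ‖primal z‖ ≤ ‖z‖ := by
  refine (pow_le_pow_iff_left₀ (norm_nonneg _) (norm_nonneg _) two_ne_zero).1 ?_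
  rw [norm_sq_eq]
  exact le_add_of_nonneg_right (Finset.sum_nonneg fun i _ => sq_nonneg _)

theorem norm_dual_le (z : PrimalDual d N) (i : Fin N) : ‖dual z i‖ ≤ ‖z‖ := by
  refine (pow_le_pow_iff_left₀ (norm_nonneg _) (norm_nonneg _) two_ne_zero).1 ?_
  rw [norm_sq_eq]
  exact le_add_of_nonneg_of_le (sq_nonneg _)
    (Finset.single_le_sum (f := fun i => ‖dual z i‖ ^ 2) (fun i _ => sq_nonneg _)
      (Finset.mem_univ i))

theorem ProblemAssumptions.continuous_gradient (h : ProblemAssumptions f L g) (i : Fin N) :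
    Continuous (∇ (f i)) := (h.lipschitz i).continuous

theorem ProblemAssumptions.continuous_prox (h : ProblemAssumptions f L g) (hlam : 0 < lam) :
    Continuous (prox lam g) :=
  (prox_lipschitz h.convex_g h.closed_g h.proper_g hlam).continuous

theorem ProblemAssumptions.continuous_stochGrad (h : ProblemAssumptions f L g) (j : Fin N) :
    Continuous (stochGrad f p j) := by
  unfold stochGrad
  have := (h.continuous_gradient j).comp (continuous_primal (N := N))
  fun_prop

theorem ProblemAssumptions.continuous_forwardSq (h : ProblemAssumptions f L g)
    (zs : PrimalDual d N) (j : Fin N) : Continuous (forwardSq f lam p zs j) := by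
  unfold forwardSq
  have := h.continuous_stochGrad (p := p) j
  fun_prop

theorem ProblemAssumptions.continuous_stepIncrement (h : ProblemAssumptions f L g) (hlam : 0 < lam)
    (zs : PrimalDual d N) (j : Fin N) : Continuous (stepIncrement f g lam p zs j) := by
  unfold stepIncrement
  have := h.continuous_stochGrad (p := p) j
  have := h.continuous_prox hlam
  fun_prop

theorem ProblemAssumptions.continuous_step (h : ProblemAssumptions f L g) (hlam : 0 < lam)
    (j : Fin N) :
    Continuous fun q : (Fin N → ℝ) × PrimalDual d N => step f g lam p j q.1 q.2 := by
  have h1 := h.continuous_stochGrad (p := p) j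
  have h2 := h.continuous_prox hlam
  refine continuous_mkPoint (by fun_prop) fun i => ?_
  have := (h.continuous_gradient i).comp (continuous_primal (N := N))
  have h3 : Continuous fun q : (Fin N → ℝ) × PrimalDual d N => ∇ (f i) (primal q.2) :=
    this.comp continuous_snd
  have h4 : Continuous fun q : (Fin N → ℝ) × PrimalDual d N => dual q.2 i :=
    (continuous_dual i).comp continuous_snd
  fun_prop

theorem continuous_gammaNorm_sq (hlam : 0 < lam) (hρ : ∀ i, 0 < ρ i) (hL : ∀ i, 0 < L i) :
    Continuous fun z : PrimalDual d N => gammaNorm lam ρ L z ^ 2 := by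
  simp only [gammaNorm_sq hlam hρ hL]
  fun_prop

/-- The weighted norm dominates a multiple of the Euclidean norm. -/
theorem exists_mul_norm_sq_le_gammaNorm_sq (hlam : 0 < lam) (hρ : ∀ i, 0 < ρ i)
    (hL : ∀ i, 0 < L i) :
    ∃ c > 0, ∀ z : PrimalDual d N, c * ‖z‖ ^ 2 ≤ gammaNorm lam ρ L z ^ 2 := by
  have hw : ∀ i : Fin N, 0 < lam / ((N : ℝ) * ρ i * L i) := by
    intro i
    have := hρ i
    have := hL i
    have : (0 : ℝ) < N := by exact_mod_cast i.pos
    positivity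
  -- `S` dominates 1 and every inverse weight, so `S⁻¹` lies below 1 and every weight.
  set S : ℝ := 1 + ∑ i, (lam / ((N : ℝ) * ρ i * L i))⁻¹ with hS
  have hsum : 0 ≤ ∑ i, (lam / ((N : ℝ) * ρ i * L i))⁻¹ :=
    Finset.sum_nonneg fun i _ => (inv_pos.2 (hw i)).le
  have hS1 : 1 ≤ S := by linarith
  have hle : ∀ i, S⁻¹ ≤ lam / ((N : ℝ) * ρ i * L i) := by
    intro i
    refine inv_le_of_inv_le₀ (hw i) ?_
    have := Finset.single_le_sum (f := fun i => (lam / ((N : ℝ) * ρ i * L i))⁻¹)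
      (fun i _ => (inv_pos.2 (hw i)).le) (Finset.mem_univ i)
    linarith
  refine ⟨S⁻¹, by positivity, fun z => ?_⟩
  rw [gammaNorm_sq hlam hρ hL, norm_sq_eq, mul_add, Finset.mul_sum]
  refine add_le_add (mul_le_of_le_one_left (sq_nonneg _) (inv_le_one_of_one_le₀ hS1))
    (Finset.sum_le_sum fun i _ => mul_le_mul_of_nonneg_right (hle i) (sq_nonneg _))

theorem gammaNorm_sq_le_mul_norm_sq (hlam : 0 < lam) (hρ : ∀ i, 0 < ρ i)
    (hL : ∀ i, 0 < L i) (z : PrimalDual d N) :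
    gammaNorm lam ρ L z ^ 2 ≤ (1 + ∑ i : Fin N, lam / ((N : ℝ) * ρ i * L i)) * ‖z‖ ^ 2 := by
  rw [gammaNorm_sq hlam hρ hL, add_mul, one_mul, Finset.sum_mul]
  refine add_le_add (pow_le_pow_left₀ (norm_nonneg _) (norm_primal_le z) 2)
    (Finset.sum_le_sum fun i _ => mul_le_mul_of_nonneg_left
      (pow_le_pow_left₀ (norm_nonneg _) (norm_dual_le z i) 2) (weight_nonneg hlam hρ hL i))

section Moments

variable {Ω : Type*} {m mΩ : MeasurableSpace Ω} {μ : Measure Ω}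

/-- For a fixed index the step is continuous in (e, z); the random index is handled by summing over
its finitely many values. -/
theorem stronglyMeasurable_step (h : ProblemAssumptions f L g) (hlam : 0 < lam)
    {J : Ω → Fin N} (hJ : Measurable[m] J) {e : Ω → Fin N → ℝ}
    (he : ∀ i, Measurable[m] fun ω => e ω i) {Z : Ω → PrimalDual d N}
    (hZ : StronglyMeasurable[m] Z) :
    StronglyMeasurable[m] fun ω => step f g lam p (J ω) (e ω) (Z ω) := by
  classical
  have heq : (fun ω => step f g lam p (J ω) (e ω) (Z ω)) = fun ω => ∑ j,
      {ω | J ω = j}.indicator (fun ω => step f g lam p j (e ω) (Z ω)) ω := by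
    funext ω
    simp [Set.indicator_apply]
  rw [heq]
  have hpair : StronglyMeasurable[m] fun ω => (e ω, Z ω) :=
    (measurable_pi_iff.2 he).stronglyMeasurable.prodMk hZ
  have hstep : ∀ j, StronglyMeasurable[m] fun ω => step f g lam p j (e ω) (Z ω) := by
    intro j
    have h1 := h.continuous_step (p := p) hlam j
    have h2 := h1.comp_stronglyMeasurable hpair
    exact h2
  exact Finset.stronglyMeasurable_fun_sum _ fun j _ =>
    (hstep j).indicator (hJ (measurableSet_singleton j))

variable {Z : Ω → PrimalDual d N}

theorem memLp_primal (hZ : MemLp Z 2 μ) : MemLp (fun ω => primal (Z ω)) 2 μ :=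
  hZ.of_le (continuous_primal.comp_aestronglyMeasurable hZ.1)
    (Eventually.of_forall fun ω => norm_primal_le (Z ω))

theorem memLp_dual (hZ : MemLp Z 2 μ) (i : Fin N) : MemLp (fun ω => dual (Z ω) i) 2 μ :=
  hZ.of_le ((continuous_dual i).comp_aestronglyMeasurable hZ.1)
    (Eventually.of_forall fun ω => norm_dual_le (Z ω) i)

theorem integrable_norm_sq {E : Type*} [NormedAddCommGroup E] {X : Ω → E} (hX : MemLp X 2 μ) :
    Integrable (fun ω => ‖X ω‖ ^ 2) μ :=
  (memLp_two_iff_integrable_sq_norm hX.1).1 hX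

variable [IsFiniteMeasure μ]

theorem memLp_gradient (h : ProblemAssumptions f L g) (hZ : MemLp Z 2 μ) (i : Fin N) :
    MemLp (fun ω => ∇ (f i) (primal (Z ω))) 2 μ :=
  (h.lipschitz i).comp_memLp_of_isFiniteMeasure (memLp_primal hZ)

theorem memLp_stochGrad (h : ProblemAssumptions f L g) (hZ : MemLp Z 2 μ) (j : Fin N) :
    MemLp (fun ω => stochGrad f p j (Z ω)) 2 μ := by
  have h1 : MemLp (fun ω => ∑ i, dual (Z ω) i) 2 μ := memLp_finsetSum _ fun i _ => memLp_dual hZ i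
  have h2 := (memLp_gradient h hZ j).sub (memLp_dual hZ j)
  exact (h2.const_smul (1 / ((N : ℝ) * p j))).add (h1.const_smul (1 / (N : ℝ)))

theorem integrable_forwardSq (h : ProblemAssumptions f L g) (hZ : MemLp Z 2 μ)
    (zs : PrimalDual d N) (j : Fin N) : Integrable (fun ω => forwardSq f lam p zs j (Z ω)) μ :=
  integrable_norm_sq (((memLp_primal hZ).sub ((memLp_stochGrad h hZ j).const_smul lam)).sub
    (memLp_const _))

theorem integrable_stepIncrement (h : ProblemAssumptions f L g) (hlam : 0 < lam)
    (hZ : MemLp Z 2 μ) (zs : PrimalDual d N) (j : Fin N) :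
    Integrable (fun ω => stepIncrement f g lam p zs j (Z ω)) μ := by
  have h1 := (memLp_primal hZ).sub ((memLp_stochGrad (p := p) h hZ j).const_smul lam)
  have h2 := (prox_lipschitz h.convex_g h.closed_g h.proper_g hlam).comp_memLp_of_isFiniteMeasure h1
  exact integrable_norm_sq ((h2.sub (memLp_primal hZ)).add
    (((memLp_stochGrad h hZ j).sub (memLp_const _)).const_smul lam))

theorem integrable_gammaNorm_sub_sq (hlam : 0 < lam) (hρ : ∀ i, 0 < ρ i) (hL : ∀ i, 0 < L i)
    (hZ : MemLp Z 2 μ) (zs : PrimalDual d N) :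
    Integrable (fun ω => gammaNorm lam ρ L (Z ω - zs) ^ 2) μ := by
  refine ((integrable_norm_sq (hZ.sub (memLp_const zs))).const_mul
    (1 + ∑ i : Fin N, lam / ((N : ℝ) * ρ i * L i))).mono' ?_ (Eventually.of_forall fun ω => ?_)
  · exact ((continuous_gammaNorm_sq hlam hρ hL).comp
      (continuous_id.sub continuous_const)).comp_aestronglyMeasurable hZ.1
  · rw [Real.norm_of_nonneg (sq_nonneg _)]
    exact gammaNorm_sq_le_mul_norm_sq hlam hρ hL _

end Moments

end BasicMethod

/-! ### Almost sure convergence and Opial's lemma -/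

section Convergence

/-- A nonnegative adapted process that decreases in conditional mean converges almost surely. -/
theorem MeasureTheory.ae_exists_tendsto_of_condExp_le {Ω : Type*} {mΩ : MeasurableSpace Ω}
    {μ : Measure Ω} [IsFiniteMeasure μ] {ℱ : Filtration ℕ mΩ} {V : ℕ → Ω → ℝ}
    (hV : StronglyAdapted ℱ V) (hint : ∀ k, Integrable (V k) μ) (h0 : ∀ k ω, 0 ≤ V k ω)
    (hle : ∀ k, μ[V (k + 1) | ℱ k] ≤ᵐ[μ] V k) :
    ∀ᵐ ω ∂μ, ∃ l, Tendsto (fun k => V k ω) atTop (𝓝 l) := by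
  have hsup := supermartingale_nat hV hint hle
  -- Doob's theorem for -V needs an L¹ bound; since V ≥ 0, its L¹ norm is its mean, which is at most
  -- that of V 0.
  have hbdd : ∀ n, eLpNorm ((-V) n) 1 μ ≤ (Real.toNNReal (∫ ω, V 0 ω ∂μ) : NNReal) := by
    intro n
    rw [Pi.neg_apply, eLpNorm_neg, eLpNorm_one_eq_lintegral_enorm,
      ← ofReal_integral_norm_eq_lintegral_enorm (hint n)]
    refine ENNReal.ofReal_le_ofReal ?_
    simp only [Real.norm_of_nonneg (h0 n _)]
    simpa using hsup.setIntegral_le (Nat.zero_le n) MeasurableSet.univ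
  filter_upwards [hsup.neg.exists_ae_tendsto_of_bdd hbdd] with ω hω
  obtain ⟨c, hc⟩ := hω
  exact ⟨-c, by simpa using hc.neg⟩

/-- The Robbins-Siegmund theorem without perturbation terms. -/
theorem MeasureTheory.ae_tendsto_of_condExp_le_sub {Ω : Type*} {mΩ : MeasurableSpace Ω}
    {μ : Measure Ω} [IsFiniteMeasure μ] {ℱ : Filtration ℕ mΩ} {V ζ : ℕ → Ω → ℝ}
    (hV : StronglyAdapted ℱ V) (hVint : ∀ k, Integrable (V k) μ) (hV0 : ∀ k ω, 0 ≤ V k ω)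
    (hζ : StronglyAdapted ℱ ζ) (hζint : ∀ k, Integrable (ζ k) μ) (hζ0 : ∀ k ω, 0 ≤ ζ k ω)
    (hle : ∀ k, μ[V (k + 1) | ℱ k] ≤ᵐ[μ] fun ω => V k ω - ζ k ω) :
    ∀ᵐ ω ∂μ, (∃ l, Tendsto (fun k => V k ω) atTop (𝓝 l)) ∧
      Tendsto (fun k => ζ k ω) atTop (𝓝 0) := by
  have h1 := ae_exists_tendsto_of_condExp_le hV hVint hV0 fun k => by
    filter_upwards [hle k] with ω hω
    linarith [hζ0 k ω]
  -- V + S also decreases in conditional mean, so both V and V + S converge and the terms of the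
  -- series tend to 0. The sum up to `k + 1` stops at ζ_k, hence is known at time `k` and passes
  -- through the conditional expectation.
  set S : ℕ → Ω → ℝ := fun k ω => ∑ i ∈ Finset.range k, ζ i ω with hS
  have hSm : ∀ k, StronglyMeasurable[ℱ k] (S (k + 1)) := fun k =>
    Finset.stronglyMeasurable_fun_sum _ fun i hi =>
      (hζ i).mono (ℱ.mono (Nat.lt_succ_iff.1 (Finset.mem_range.1 hi)))
  have hSint : ∀ k, Integrable (S k) μ := fun k => integrable_finsetSum _ fun i _ => hζint i
  have hadp : StronglyAdapted ℱ fun k => V k + S k := by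
    intro k
    refine (hV k).add ?_
    cases k with
    | zero => simpa [hS] using! stronglyMeasurable_const
    | succ k => exact (hSm k).mono (ℱ.mono k.le_succ)
  have h2 := ae_exists_tendsto_of_condExp_le (V := fun k => V k + S k) (μ := μ) hadp
    (fun k => (hVint k).add (hSint k))
    (fun k ω => add_nonneg (hV0 k ω) (Finset.sum_nonneg fun i _ => hζ0 i ω)) fun k => by
      filter_upwards [hle k, condExp_add (hVint (k + 1)) (hSint (k + 1)) (ℱ k)] with ω h3 h4
      rw [h4, Pi.add_apply, condExp_of_stronglyMeasurable (ℱ.le k) (hSm k) (hSint (k + 1)),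
        Pi.add_apply]
      simp only [hS, Finset.sum_range_succ]
      linarith
  filter_upwards [h1, h2] with ω ⟨l, hl⟩ ⟨l', hl'⟩
  refine ⟨⟨l, hl⟩, ?_⟩
  have h3 : Tendsto (fun k => S k ω) atTop (𝓝 (l' - l)) := by
    simpa using hl'.sub hl
  have h4 := (h3.comp (tendsto_add_atTop_nat 1)).sub h3
  rw [sub_self] at h4
  refine h4.congr fun k => ?_
  simp [hS, Finset.sum_range_succ]

/-- Opial's lemma for a weighted quadratic distance `Q`. -/
theorem exists_tendsto_of_forall_tendsto_quadratic {E : Type*} [NormedAddCommGroup E]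
    [ProperSpace E] {Q : E → ℝ} (hQ : Continuous Q) {c C : ℝ} (hc : 0 < c) (hC : 0 ≤ C)
    (hlow : ∀ x, c * ‖x‖ ^ 2 ≤ Q x) (hup : ∀ x, Q x ≤ C * ‖x‖ ^ 2) {S : Set E} {s : ℕ → E}
    (hs : S ⊆ closure (Set.range s)) {z : ℕ → E}
    (hlim : ∀ n, ∃ l, Tendsto (fun k => Q (z k - s n)) atTop (𝓝 l))
    (hcl : ∀ (x : E) (φ : ℕ → ℕ), StrictMono φ → Tendsto (z ∘ φ) atTop (𝓝 x) → x ∈ S) :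
    ∃ x ∈ S, Tendsto z atTop (𝓝 x) := by
  have hbdd : Bornology.IsBounded (Set.range z) := by
    obtain ⟨l, hl⟩ := hlim 0
    obtain ⟨B, hB⟩ := hl.bddAbove_range
    refine (Metric.isBounded_closedBall (x := s 0) (r := √(B / c))).subset ?_
    rintro _ ⟨k, rfl⟩
    rw [Metric.mem_closedBall, dist_eq_norm]
    refine Real.le_sqrt_of_sq_le ?_
    rw [le_div_iff₀ hc, mul_comm]
    exact (hlow _).trans (hB ⟨k, rfl⟩)
  obtain ⟨x, -, φ, hφ, hx⟩ := tendsto_subseq_of_bounded hbdd fun n => Set.mem_range_self n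
  have hxS := hcl x φ hφ hx
  refine ⟨x, hxS, Metric.tendsto_atTop.2 fun ε hε => ?_⟩
  -- If ‖x - s n‖ < δ, the limit of Q(z_k - s n) is below (C + c)δ², the added c making this strict.
  -- The lower bound on Q then gives ‖z_k - s n‖ ≤ Kδ eventually, and δ is chosen so that Kδ + δ =
  -- ε.
  set K : ℝ := √((C + c) / c) with hK
  have hK0 : 0 ≤ K := Real.sqrt_nonneg _
  set δ : ℝ := ε / (K + 1) with hδ
  have hδ0 : 0 < δ := by positivity
  obtain ⟨_, ⟨n, rfl⟩, hn⟩ := Metric.mem_closure_iff.1 (hs hxS) δ hδ0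
  rw [dist_eq_norm] at hn
  obtain ⟨l, hl⟩ := hlim n
  have hl' : l = Q (x - s n) :=
    tendsto_nhds_unique (hl.comp hφ.tendsto_atTop)
      ((hQ.tendsto _).comp (hx.sub tendsto_const_nhds))
  have hlt : l < (C + c) * δ ^ 2 := by
    have h1 : ‖x - s n‖ ^ 2 ≤ δ ^ 2 := pow_le_pow_left₀ (norm_nonneg _) hn.le 2
    have h2 := hup (x - s n)
    have h3 := mul_le_mul_of_nonneg_left h1 hC
    have h4 : 0 < c * δ ^ 2 := by positivity
    rw [hl']; linarith
  obtain ⟨k₀, hk₀⟩ := eventually_atTop.1 (hl.eventually_lt_const hlt)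
  refine ⟨k₀, fun k hk => ?_⟩
  have h1 := (hlow _).trans_lt (hk₀ k hk)
  have h2 : ‖z k - s n‖ ≤ K * δ := by
    rw [hK, ← Real.sqrt_sq hδ0.le, ← Real.sqrt_mul (by positivity)]
    refine Real.le_sqrt_of_sq_le ?_
    rw [div_mul_eq_mul_div, le_div_iff₀ hc]
    linarith
  calc dist (z k) x ≤ dist (z k) (s n) + dist (s n) x := dist_triangle _ _ _
    _ = ‖z k - s n‖ + ‖x - s n‖ := by rw [dist_eq_norm, dist_comm, dist_eq_norm]
    _ < K * δ + δ := add_lt_add_of_le_of_lt h2 hn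
    _ = ε := by rw [hδ]; field_simp

end Convergence

/-! ### The decrease as a function of the iterate -/

namespace BasicMethod

variable {d N : ℕ} {f : Fin N → Primal d → ℝ} {L : Fin N → ℝ} {g : Primal d → EReal} {lam : ℝ}
  {p ρ : Fin N → ℝ}

theorem ProblemAssumptions.continuous_decrease (h : ProblemAssumptions f L g)
    (zs : PrimalDual d N) : Continuous (decrease f L lam p zs) := by
  have h1 : ∀ i, Continuous fun z : PrimalDual d N => ∇ (f i) (primal z) := fun i =>
    (h.continuous_gradient i).comp continuous_primal
  have h2 : Continuous fun z : PrimalDual d N => ∇ (avg f) (primal z) := by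
    simp only [gradient_avg h.differentiable]
    fun_prop
  unfold decrease
  fun_prop

theorem ProblemAssumptions.isClosed_zer (h : ProblemAssumptions f L g) (hlam : 0 < lam) :
    IsClosed (zer f g lam) := by
  have h1 : ∀ i, Continuous fun z : PrimalDual d N => ∇ (f i) (primal z) := fun i =>
    (h.continuous_gradient i).comp continuous_primal
  have h2 := h.continuous_prox hlam
  have h3 : Continuous (residual f g lam) := continuous_mkPoint (by fun_prop) fun i => by fun_prop
  exact isClosed_singleton.preimage h3

/-- The conditional mean of `ζ_k` as a function of the current iterate. -/
noncomputable def totalDecrease (f : Fin N → Primal d → ℝ) (L : Fin N → ℝ) (g : Primal d → EReal)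
    (lam : ℝ) (p : Fin N → ℝ) (zs z : PrimalDual d N) : ℝ :=
  decrease f L lam p zs z + ∑ j, p j * stepIncrement f g lam p zs j z

/-- This is where the step-size condition enters: it says exactly that 1/L_i exceeds 2λ/(Np_i). -/
theorem stepSize_coeff_pos (hL : ∀ i, 0 < L i) (hlam : 0 < lam) (hp : ∀ i, 0 < p i)
    (hstep : ∀ i, lam < (N : ℝ) * p i / (2 * L i)) (i : Fin N) :
    0 < lam / (N : ℝ) * (1 / L i - 2 * lam / ((N : ℝ) * p i)) := by
  have hN : (0 : ℝ) < N := by exact_mod_cast i.pos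
  have h1 := hL i
  have h2 := hp i
  refine mul_pos (by positivity) (sub_pos.2 ?_)
  have h3 := (lt_div_iff₀ (by positivity)).1 (hstep i)
  rw [div_lt_div_iff₀ (by positivity) h1]
  linarith

theorem sum_coeff_mul_nonneg (hL : ∀ i, 0 < L i) (hlam : 0 < lam) (hp : ∀ i, 0 < p i)
    (hstep : ∀ i, lam < (N : ℝ) * p i / (2 * L i)) (zs z : PrimalDual d N) (i : Fin N) :
    0 ≤ lam / (N : ℝ) * (1 / L i - 2 * lam / ((N : ℝ) * p i)) *
      (‖∇ (f i) (primal z) - ∇ (f i) (primal zs)‖ ^ 2 + ‖dual z i - dual zs i‖ ^ 2) :=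
  mul_nonneg (stepSize_coeff_pos hL hlam hp hstep i).le (by positivity)

theorem totalDecrease_nonneg (hL : ∀ i, 0 < L i) (hlam : 0 < lam) (hp : ∀ i, 0 < p i)
    (hstep : ∀ i, lam < (N : ℝ) * p i / (2 * L i)) (zs z : PrimalDual d N) :
    0 ≤ totalDecrease f L g lam p zs z := by
  have h1 := Finset.sum_nonneg fun i (_ : i ∈ Finset.univ) =>
    sum_coeff_mul_nonneg (f := f) hL hlam hp hstep zs z i
  have h2 : 0 ≤ ∑ j, p j * stepIncrement f g lam p zs j z :=
    Finset.sum_nonneg fun j _ => mul_nonneg (hp j).le (sq_nonneg _)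
  unfold totalDecrease decrease
  positivity

/-- A point at which the decrease vanishes is a zero of the residual. -/
theorem mem_zer_of_totalDecrease_eq_zero (h : ProblemAssumptions f L g) (hlam : 0 < lam)
    (hp : ∀ i, 0 < p i) (j : Fin N)
    (hstep : ∀ i, lam < (N : ℝ) * p i / (2 * L i)) {zs z : PrimalDual d N}
    (hzs : zs ∈ zer f g lam) (hz : totalDecrease f L g lam p zs z = 0) : z ∈ zer f g lam := by
  obtain ⟨-, hy⟩ := (mem_zer_iff_prox h zs).1 hzs
  have h1 := sum_coeff_mul_nonneg (f := f) h.L_pos hlam hp hstep zs z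
  have h2 : ∀ j ∈ Finset.univ, 0 ≤ p j * stepIncrement f g lam p zs j z :=
    fun j _ => mul_nonneg (hp j).le (sq_nonneg _)
  have h3 := Finset.sum_nonneg fun i (_ : i ∈ Finset.univ) => h1 i
  have h4 := Finset.sum_nonneg h2
  have h5 : 0 ≤ 2 * lam ^ 2 / (N : ℝ) ^ 2 * ‖∑ i, (dual z i - dual zs i)‖ ^ 2 := by positivity
  have h6 : 0 ≤ lam ^ 2 * ‖∇ (avg f) (primal z) - ∇ (avg f) (primal zs)‖ ^ 2 := by positivity
  rw [totalDecrease, decrease] at hz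
  have hinc := (Finset.sum_eq_zero_iff_of_nonneg h2).1 (by linarith) j (Finset.mem_univ j)
  have hcoef := fun i => (Finset.sum_eq_zero_iff_of_nonneg fun i _ => h1 i).1 (by linarith) i
    (Finset.mem_univ i)
  have hgd : ∀ i, ∇ (f i) (primal z) = ∇ (f i) (primal zs) ∧ dual z i = dual zs i := by
    intro i
    have h7 := (mul_eq_zero.1 (hcoef i)).resolve_left
      (stepSize_coeff_pos h.L_pos hlam hp hstep i).ne'
    have h8 := (add_eq_zero_iff_of_nonneg (sq_nonneg _) (sq_nonneg _)).1 h7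
    exact ⟨sub_eq_zero.1 (norm_eq_zero.1 (pow_eq_zero_iff two_ne_zero |>.1 h8.1)),
      sub_eq_zero.1 (norm_eq_zero.1 (pow_eq_zero_iff two_ne_zero |>.1 h8.2))⟩
  have havg : ∇ (avg f) (primal zs) = ∇ (avg f) (primal z) := by
    rw [gradient_avg h.differentiable, gradient_avg h.differentiable]
    simp only [(hgd _).1]
  have hdz : ∀ i, dual z i = ∇ (f i) (primal z) := fun i => by
    rw [(hgd i).1, (hgd i).2, hy i]
  -- With y_j = ∇f_j(x) the correction vanishes and the estimator equals ∇F(x), so a vanishing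
  -- increment for a single index is already the fixed-point equation.
  have hstoch : stochGrad f p j z = ∇ (avg f) (primal z) := by
    rw [stochGrad, hdz j, sub_self, smul_zero, zero_add, gradient_avg h.differentiable]
    simp only [hdz]
  refine (mem_zer_iff_prox h z).2 ⟨?_, hdz⟩
  have h9 := (mul_eq_zero.1 hinc).resolve_left (hp j).ne'
  rw [stepIncrement, hstoch, havg, sub_self, smul_zero, add_zero, pow_eq_zero_iff two_ne_zero,
    norm_eq_zero, sub_eq_zero] at h9
  exact h9

end BasicMethod

/-! ### Conditional estimates along the iterates -/

namespace BasicMethod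

variable {d N : ℕ} {f : Fin N → Primal d → ℝ} {L : Fin N → ℝ} {g : Primal d → EReal} {lam : ℝ}
  {p ρ : Fin N → ℝ} {Ω : Type*}

/-- A pointwise upper bound for the squared distance to `zs` after one step. -/
noncomputable def stepBound (f : Fin N → Primal d → ℝ) (g : Primal d → EReal) (L : Fin N → ℝ)
    (lam : ℝ) (p ρ : Fin N → ℝ) (zs : PrimalDual d N) (j : Fin N) (e : Fin N → ℝ)
    (z : PrimalDual d N) : ℝ :=
  forwardSq f lam p zs j z - stepIncrement f g lam p zs j z
    + ∑ i, lam / ((N : ℝ) * ρ i * L i) * (‖dual z i - dual zs i‖ ^ 2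
      + e i * (‖∇ (f i) (primal z) - ∇ (f i) (primal zs)‖ ^ 2 - ‖dual z i - dual zs i‖ ^ 2))

section OneStep

variable {m mΩ : MeasurableSpace Ω} {μ : Measure Ω} [IsFiniteMeasure μ] {J : Ω → Fin N}
  {e : Ω → Fin N → ℝ} {Z : Ω → PrimalDual d N}

theorem condExp_stepIncrement (h : ProblemAssumptions f L g) (hlam : 0 < lam)
    (hJ : Measurable J) (hpJ : ∀ j, μ⟦{ω | J ω = j} | m⟧ =ᵐ[μ] fun _ => p j)
    (hZm : StronglyMeasurable[m] Z) (hZ : MemLp Z 2 μ) (zs : PrimalDual d N) :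
    μ[fun ω => stepIncrement f g lam p zs (J ω) (Z ω) | m]
      =ᵐ[μ] fun ω => ∑ j, p j * stepIncrement f g lam p zs j (Z ω) :=
  condExp_finite_choice (F := fun j ω => stepIncrement f g lam p zs j (Z ω))
    (fun j => hJ (measurableSet_singleton j)) hpJ
    (fun j => (h.continuous_stepIncrement hlam zs j).comp_stronglyMeasurable hZm)
    (fun j => integrable_stepIncrement h hlam hZ zs j)

theorem integrable_gradient_sub_sq (h : ProblemAssumptions f L g) (hZ : MemLp Z 2 μ)
    (zs : PrimalDual d N) (i : Fin N) :
    Integrable (fun ω => ‖∇ (f i) (primal (Z ω)) - ∇ (f i) (primal zs)‖ ^ 2) μ :=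
  integrable_norm_sq ((memLp_gradient h hZ i).sub (memLp_const _))

theorem integrable_dual_sub_sq (hZ : MemLp Z 2 μ) (zs : PrimalDual d N) (i : Fin N) :
    Integrable (fun ω => ‖dual (Z ω) i - dual zs i‖ ^ 2) μ :=
  integrable_norm_sq ((memLp_dual hZ i).sub (memLp_const _))

theorem eq_indicator_of_binary {u : Ω → ℝ} (hu : ∀ ω, u ω = 0 ∨ u ω = 1) :
    u = {ω | u ω = 1}.indicator fun _ => (1 : ℝ) := by
  funext ω
  rcases hu ω with h0 | h1
  · rw [Set.indicator_of_notMem (by simp [h0]), h0]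
  · rw [Set.indicator_of_mem (by simp [h1]), h1]

theorem integrable_stepBound (h : ProblemAssumptions f L g) (hlam : 0 < lam) (hJ : Measurable J)
    (he : ∀ i, Measurable fun ω => e ω i) (he01 : ∀ ω i, e ω i = 0 ∨ e ω i = 1)
    (hZ : MemLp Z 2 μ) (zs : PrimalDual d N) :
    Integrable (fun ω => stepBound f g L lam p ρ zs (J ω) (e ω) (Z ω)) μ := by
  have hJs : ∀ j, MeasurableSet {ω | J ω = j} := fun j => hJ (measurableSet_singleton j)
  refine ((Integrable.finite_choice hJs fun j => integrable_forwardSq h hZ zs j).sub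
    (Integrable.finite_choice hJs fun j => integrable_stepIncrement h hlam hZ zs j)).add
    (integrable_finsetSum _ fun i _ => ((integrable_dual_sub_sq hZ zs i).add ?_).const_mul _)
  have h1 := ((integrable_gradient_sub_sq h hZ zs i).sub
    (integrable_dual_sub_sq hZ zs i)).indicator_one_mul (he i (measurableSet_singleton 1))
  have h2 := eq_indicator_of_binary fun ω => he01 ω i
  refine h1.congr (Eventually.of_forall fun ω => ?_)
  exact congrArg (· * _) (congrFun h2 ω).symm

/-- Each random term contains either the index or a single ε_i, multiplied by quantities known
before the draw; marginal laws therefore suffice, whatever the joint law. -/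
theorem condExp_stepBound_le (h : ProblemAssumptions f L g) (hlam : 0 < lam)
    (hp : ∀ i, 0 < p i) (hp1 : ∑ i, p i = 1) (hρ : ∀ i, 0 < ρ i) (hm : m ≤ mΩ)
    (hJ : Measurable J) (hpJ : ∀ j, μ⟦{ω | J ω = j} | m⟧ =ᵐ[μ] fun _ => p j)
    (he : ∀ i, Measurable fun ω => e ω i) (he01 : ∀ ω i, e ω i = 0 ∨ e ω i = 1)
    (hρe : ∀ i, μ⟦{ω | e ω i = 1} | m⟧ =ᵐ[μ] fun _ => ρ i)
    (hZm : StronglyMeasurable[m] Z) (hZ : MemLp Z 2 μ) {zs : PrimalDual d N}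
    (hzs : zs ∈ zer f g lam) :
    μ[fun ω => stepBound f g L lam p ρ zs (J ω) (e ω) (Z ω) | m] ≤ᵐ[μ]
      fun ω => gammaNorm lam ρ L (Z ω - zs) ^ 2 - totalDecrease f L g lam p zs (Z ω) := by
  have hJs : ∀ j, MeasurableSet {ω | J ω = j} := fun j => hJ (measurableSet_singleton j)
  have hes : ∀ i, MeasurableSet {ω | e ω i = 1} := fun i => he i (measurableSet_singleton 1)
  let D : Fin N → Ω → ℝ := fun i ω =>
    ‖∇ (f i) (primal (Z ω)) - ∇ (f i) (primal zs)‖ ^ 2 - ‖dual (Z ω) i - dual zs i‖ ^ 2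
  let T : Fin N → Ω → ℝ := fun i => (lam / ((N : ℝ) * ρ i * L i)) •
    ((fun ω => ‖dual (Z ω) i - dual zs i‖ ^ 2)
      + {ω | e ω i = 1}.indicator (fun _ => (1 : ℝ)) * D i)
  have hDint : ∀ i, Integrable (D i) μ := fun i =>
    (integrable_gradient_sub_sq h hZ zs i).sub (integrable_dual_sub_sq hZ zs i)
  have hbm : ∀ i, StronglyMeasurable[m] fun ω => ‖dual (Z ω) i - dual zs i‖ ^ 2 := fun i =>
    (by fun_prop : Continuous fun z : PrimalDual d N =>
      ‖dual z i - dual zs i‖ ^ 2).comp_stronglyMeasurable hZm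
  have ham : ∀ i, StronglyMeasurable[m]
      fun ω => ‖∇ (f i) (primal (Z ω)) - ∇ (f i) (primal zs)‖ ^ 2 := fun i =>
    ((((h.continuous_gradient i).comp continuous_primal).sub
      continuous_const).norm.pow 2).comp_stronglyMeasurable hZm
  have hDm : ∀ i, StronglyMeasurable[m] (D i) := fun i => (ham i).sub (hbm i)
  have hTint : ∀ i, Integrable (T i) μ := fun i => Integrable.smul _
    ((integrable_dual_sub_sq hZ zs i).add ((hDint i).indicator_one_mul (hes i)))
  have hT : ∀ i, μ[T i | m] =ᵐ[μ] fun ω => lam / ((N : ℝ) * ρ i * L i) *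
      (‖dual (Z ω) i - dual zs i‖ ^ 2 + ρ i * D i ω) := by
    intro i
    filter_upwards [condExp_smul (μ := μ) (lam / ((N : ℝ) * ρ i * L i))
        ((fun ω => ‖dual (Z ω) i - dual zs i‖ ^ 2)
          + {ω | e ω i = 1}.indicator (fun _ => (1 : ℝ)) * D i) m,
      condExp_add (integrable_dual_sub_sq hZ zs i) ((hDint i).indicator_one_mul (hes i)) m,
      condExp_indicator_one_mul (hes i) (hρe i) (hDm i) (hDint i)] with ω h1 h2 h3
    rw [h1, Pi.smul_apply, h2, Pi.add_apply, h3,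
      condExp_of_stronglyMeasurable hm (hbm i) (integrable_dual_sub_sq hZ zs i), smul_eq_mul]
  have hfwd := condExp_finite_choice (F := fun j ω => forwardSq f lam p zs j (Z ω)) hJs hpJ
    (fun j => (h.continuous_forwardSq zs j).comp_stronglyMeasurable hZm)
    (fun j => integrable_forwardSq h hZ zs j)
  have hfint := Integrable.finite_choice hJs fun j => integrable_forwardSq (lam := lam) (p := p) h hZ zs j
  have hiint := Integrable.finite_choice hJs fun j =>
    integrable_stepIncrement (p := p) h hlam hZ zs j
  have heq : (fun ω => stepBound f g L lam p ρ zs (J ω) (e ω) (Z ω))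
      = ((fun ω => forwardSq f lam p zs (J ω) (Z ω))
        - fun ω => stepIncrement f g lam p zs (J ω) (Z ω)) + ∑ i, T i := by
    funext ω
    rw [Pi.add_apply, Pi.sub_apply, Finset.sum_apply, stepBound]
    congr 1
    refine Finset.sum_congr rfl fun i _ => ?_
    have h2 := congrFun (eq_indicator_of_binary fun ω => he01 ω i) ω
    rw [h2]
    rfl
  rw [heq]
  filter_upwards [condExp_add (hfint.sub hiint)
      (integrable_finsetSum' Finset.univ fun i _ => hTint i) m,
    condExp_sub hfint hiint m, condExp_finsetSum (s := Finset.univ) (fun i _ => hTint i) m, hfwd,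
    condExp_stepIncrement h hlam hJ hpJ hZm hZ zs, ae_all_iff.2 hT] with ω h1 h2 h3 h4 h5 h6
  rw [h1, Pi.add_apply, h2, Pi.sub_apply, h3, Finset.sum_apply, h4, h5]
  simp only [h6]
  have := expected_step_le h hlam hp hp1 hρ hzs (Z ω)
  simp only [totalDecrease, D]
  linarith

theorem integrable_gammaNorm_step_sub_sq (h : ProblemAssumptions f L g) (hlam : 0 < lam)
    (hρ : ∀ i, 0 < ρ i) (hJ : Measurable J)
    (he : ∀ i, Measurable fun ω => e ω i) (he01 : ∀ ω i, e ω i = 0 ∨ e ω i = 1)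
    (hZm : StronglyMeasurable Z) (hZ : MemLp Z 2 μ) {zs : PrimalDual d N}
    (hzs : zs ∈ zer f g lam) :
    Integrable (fun ω => gammaNorm lam ρ L (step f g lam p (J ω) (e ω) (Z ω) - zs) ^ 2) μ := by
  refine (integrable_stepBound (p := p) (ρ := ρ) h hlam hJ he he01 hZ zs).mono' ?_
    (Eventually.of_forall fun ω => ?_)
  · have h1 := (continuous_gammaNorm_sq hlam hρ h.L_pos).comp
      ((continuous_id (X := PrimalDual d N)).sub (continuous_const (y := zs)))
    exact (h1.comp_stronglyMeasurable
      (stronglyMeasurable_step h hlam hJ he hZm)).aestronglyMeasurable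
  · rw [Real.norm_of_nonneg (sq_nonneg _)]
    exact gammaNorm_step_sub_sq_le h hlam hρ hzs (J ω) (he01 ω) (Z ω)

/-- The pointwise bound makes the squared weighted distance to some zero integrable. All positive
weights give equivalent norms, so ρ = 1 is taken. -/
theorem memLp_step (h : ProblemAssumptions f L g) (hlam : 0 < lam) (hJ : Measurable J)
    (he : ∀ i, Measurable fun ω => e ω i) (he01 : ∀ ω i, e ω i = 0 ∨ e ω i = 1)
    (hZm : StronglyMeasurable Z) (hZ : MemLp Z 2 μ) :
    MemLp (fun ω => step f g lam p (J ω) (e ω) (Z ω)) 2 μ := by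
  obtain ⟨zs, hzs⟩ := zer_nonempty h hlam
  obtain ⟨c, hc, hle⟩ := exists_mul_norm_sq_le_gammaNorm_sq (N := N) (d := d) (ρ := fun _ => 1) hlam
    (fun _ => one_pos) h.L_pos
  have hmeas := stronglyMeasurable_step (p := p) h hlam hJ he hZm
  have hsub : MemLp (fun ω => step f g lam p (J ω) (e ω) (Z ω) - zs) 2 μ := by
    have hm : AEStronglyMeasurable (fun ω => step f g lam p (J ω) (e ω) (Z ω) - zs) μ :=
      (hmeas.sub stronglyMeasurable_const).aestronglyMeasurable
    refine (memLp_two_iff_integrable_sq_norm hm).2 ?_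
    refine ((integrable_gammaNorm_step_sub_sq (p := p) (ρ := fun _ => 1) h hlam
      (fun _ => one_pos) hJ he he01 hZm hZ hzs).const_mul c⁻¹).mono' (hm.norm.pow 2)
      (Eventually.of_forall fun ω => ?_)
    rw [Real.norm_of_nonneg (sq_nonneg _), ← div_eq_inv_mul, le_div_iff₀ hc, mul_comm]
    exact hle _
  have := hsub.add (memLp_const zs)
  refine this.ae_eq (Eventually.of_forall fun ω => ?_)
  simp

end OneStep

section Iterates

variable {mΩ : MeasurableSpace Ω} {μ : Measure Ω} {ℱ : Filtration ℕ mΩ} {idx : ℕ → Ω → Fin N}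
  {eps : ℕ → Ω → Fin N → ℝ} {z0 : Ω → PrimalDual d N}

theorem IsSampling.measurable_idx' (hs : IsSampling μ ℱ p ρ idx eps) (k : ℕ) :
    Measurable (idx k) := (hs.measurable_idx k).mono (ℱ.le _) le_rfl

theorem IsSampling.measurable_eps' (hs : IsSampling μ ℱ p ρ idx eps) (k : ℕ) (i : Fin N) :
    Measurable fun ω => eps k ω i := (hs.measurable_eps k i).mono (ℱ.le _) le_rfl

/-- The sampling probabilities sum up to one. -/
theorem IsSampling.sum_eq_one [IsProbabilityMeasure μ] (hs : IsSampling μ ℱ p ρ idx eps) :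
    ∑ i, p i = 1 := by
  -- The constant 1, viewed as selected by the index, has conditional mean ∑ p_j.
  have h1 := condExp_finite_choice (F := fun (_ : Fin N) (_ : Ω) => (1 : ℝ))
    (fun j => hs.measurable_idx' 0 (measurableSet_singleton j)) (hs.prob_idx 0)
    (fun _ => stronglyMeasurable_const) (fun _ => integrable_const 1)
  rw [condExp_const (ℱ.le 0)] at h1
  obtain ⟨ω, hω⟩ := h1.exists
  simpa using hω.symm

theorem stronglyMeasurable_iter (h : ProblemAssumptions f L g) (hlam : 0 < lam)
    (hs : IsSampling μ ℱ p ρ idx eps) (hz0 : StronglyMeasurable[ℱ 0] z0) (k : ℕ) :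
    StronglyMeasurable[ℱ k] (iter f g lam p idx eps z0 k) := by
  induction k with
  | zero => exact hz0
  | succ k ih =>
    exact stronglyMeasurable_step h hlam (hs.measurable_idx k) (hs.measurable_eps k)
      (ih.mono (ℱ.mono k.le_succ))

theorem memLp_iter [IsFiniteMeasure μ] (h : ProblemAssumptions f L g) (hlam : 0 < lam)
    (hs : IsSampling μ ℱ p ρ idx eps) (hz0 : StronglyMeasurable[ℱ 0] z0) (hz0L2 : MemLp z0 2 μ)
    (k : ℕ) : MemLp (iter f g lam p idx eps z0 k) 2 μ := by
  induction k with
  | zero => exact hz0L2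
  | succ k ih =>
    exact memLp_step h hlam (hs.measurable_idx' k) (hs.measurable_eps' k) (hs.binary k)
      ((stronglyMeasurable_iter h hlam hs hz0 k).mono (ℱ.le k)) ih

/-- The conditional one-step inequality along the iterates. -/
theorem condExp_gammaNorm_iter_le [IsProbabilityMeasure μ] (h : ProblemAssumptions f L g)
    (hlam : 0 < lam) (hp : ∀ i, 0 < p i) (hρ : ∀ i, 0 < ρ i)
    (hs : IsSampling μ ℱ p ρ idx eps) (hz0 : StronglyMeasurable[ℱ 0] z0) (hz0L2 : MemLp z0 2 μ)
    {zs : PrimalDual d N} (hzs : zs ∈ zer f g lam) (k : ℕ) :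
    μ[fun ω => gammaNorm lam ρ L (iter f g lam p idx eps z0 (k + 1) ω - zs) ^ 2 | ℱ k] ≤ᵐ[μ]
      fun ω => gammaNorm lam ρ L (iter f g lam p idx eps z0 k ω - zs) ^ 2
        - totalDecrease f L g lam p zs (iter f g lam p idx eps z0 k ω) := by
  have hZm := stronglyMeasurable_iter h hlam hs hz0 k
  have hZ := memLp_iter h hlam hs hz0 hz0L2 k
  refine (condExp_mono
    (integrable_gammaNorm_step_sub_sq h hlam hρ (hs.measurable_idx' k) (hs.measurable_eps' k)
      (hs.binary k) (hZm.mono (ℱ.le k)) hZ hzs)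
    (integrable_stepBound (p := p) (ρ := ρ) h hlam (hs.measurable_idx' k) (hs.measurable_eps' k)
      (hs.binary k) hZ zs)
    (Eventually.of_forall fun ω =>
      gammaNorm_step_sub_sq_le h hlam hρ hzs (idx k ω) (hs.binary k ω) _)).trans ?_
  exact condExp_stepBound_le h hlam hp hs.sum_eq_one hρ (ℱ.le k) (hs.measurable_idx' k)
    (hs.prob_idx k) (hs.measurable_eps' k) (hs.binary k) (hs.prob_eps k) hZm hZ hzs

/-- Replaces the conditional expectation in ζ_k by a finite sum that is continuous in the iterate,
so that limits along subsequences can be taken. -/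
theorem zeta_ae_eq [IsFiniteMeasure μ] (h : ProblemAssumptions f L g)
    (hlam : 0 < lam) (hs : IsSampling μ ℱ p ρ idx eps) (hz0 : StronglyMeasurable[ℱ 0] z0)
    (hz0L2 : MemLp z0 2 μ) (zs : PrimalDual d N) (k : ℕ) :
    zeta μ ℱ f L g lam p idx eps z0 zs k =ᵐ[μ]
      fun ω => totalDecrease f L g lam p zs (iter f g lam p idx eps z0 k ω) := by
  filter_upwards [condExp_stepIncrement h hlam (hs.measurable_idx' k) (hs.prob_idx k)
    (stronglyMeasurable_iter h hlam hs hz0 k) (memLp_iter h hlam hs hz0 hz0L2 k) zs] with ω hω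
  exact congrArg (decrease f L lam p zs (iter f g lam p idx eps z0 k ω) + ·) hω

theorem integrable_decrease [IsFiniteMeasure μ] (h : ProblemAssumptions f L g)
    {Z : Ω → PrimalDual d N} (hZ : MemLp Z 2 μ) (zs : PrimalDual d N) :
    Integrable (fun ω => decrease f L lam p zs (Z ω)) μ := by
  have h1 : MemLp (fun ω => ∇ (avg f) (primal (Z ω))) 2 μ := by
    simp only [gradient_avg h.differentiable]
    exact (memLp_finsetSum _ fun i _ => memLp_gradient h hZ i).const_smul (1 / (N : ℝ))
  have h2 : MemLp (fun ω => ∑ i, (dual (Z ω) i - dual zs i)) 2 μ :=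
    memLp_finsetSum _ fun i _ => (memLp_dual hZ i).sub (memLp_const _)
  exact ((integrable_finsetSum _ fun i _ => ((integrable_gradient_sub_sq h hZ zs i).add
    (integrable_dual_sub_sq hZ zs i)).const_mul _).add
      ((integrable_norm_sq h2).const_mul _)).add
        ((integrable_norm_sq (h1.sub (memLp_const _))).const_mul _)

/-- Almost sure convergence of the iterates to a random zero of the residual. -/
theorem ae_exists_tendsto_iter [IsProbabilityMeasure μ] (h : ProblemAssumptions f L g)
    (hlam : 0 < lam) (hp : ∀ i, 0 < p i) (hρ : ∀ i, 0 < ρ i)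
    (hs : IsSampling μ ℱ p ρ idx eps) (hz0 : StronglyMeasurable[ℱ 0] z0) (hz0L2 : MemLp z0 2 μ)
    (hstep : ∀ i, lam < (N : ℝ) * p i / (2 * L i)) :
    ∀ᵐ ω ∂μ, ∃ z ∈ zer f g lam,
      Tendsto (fun k => iter f g lam p idx eps z0 k ω) atTop (𝓝 z) := by
  have hne := zer_nonempty h hlam
  have : Nonempty (zer f g lam) := hne.to_subtype
  -- The exceptional null set depends on the chosen zero, so only countably many zeros may be used.
  let s : ℕ → PrimalDual d N := fun n => (TopologicalSpace.denseSeq (zer f g lam) n : PrimalDual d N)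
  have hsz : ∀ n, s n ∈ zer f g lam := fun n => (TopologicalSpace.denseSeq (zer f g lam) n).2
  have hdense : zer f g lam ⊆ closure (Set.range s) := by
    intro z hz
    refine Metric.mem_closure_iff.2 fun ε hε => ?_
    obtain ⟨n, hn⟩ :=
      (TopologicalSpace.denseRange_denseSeq (zer f g lam)).exists_dist_lt ⟨z, hz⟩ hε
    exact ⟨s n, ⟨n, rfl⟩, hn⟩
  have htc : ∀ zs, Continuous (totalDecrease f L g lam p zs) := by
    intro zs
    have h1 := h.continuous_decrease (lam := lam) (p := p) zs
    have h2 := h.continuous_stepIncrement (p := p) hlam zs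
    unfold totalDecrease
    fun_prop
  have hVc := continuous_gammaNorm_sq (d := d) hlam hρ h.L_pos
  have hconv : ∀ᵐ ω ∂μ, ∀ n,
      (∃ l, Tendsto (fun k => gammaNorm lam ρ L (iter f g lam p idx eps z0 k ω - s n) ^ 2)
        atTop (𝓝 l)) ∧
      Tendsto (fun k => totalDecrease f L g lam p (s n) (iter f g lam p idx eps z0 k ω))
        atTop (𝓝 0) := by
    refine ae_all_iff.2 fun n => ae_tendsto_of_condExp_le_sub (ℱ := ℱ)
      (V := fun k ω => gammaNorm lam ρ L (iter f g lam p idx eps z0 k ω - s n) ^ 2)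
      (ζ := fun k ω => totalDecrease f L g lam p (s n) (iter f g lam p idx eps z0 k ω))
      (fun k => ?_) (fun k => ?_) (fun k ω => sq_nonneg _) (fun k => ?_) (fun k => ?_)
      (fun k ω => totalDecrease_nonneg h.L_pos hlam hp hstep _ _)
      (condExp_gammaNorm_iter_le h hlam hp hρ hs hz0 hz0L2 (hsz n))
    · exact (hVc.comp (continuous_id.sub continuous_const)).comp_stronglyMeasurable
        (stronglyMeasurable_iter h hlam hs hz0 k)
    · exact integrable_gammaNorm_sub_sq hlam hρ h.L_pos (memLp_iter h hlam hs hz0 hz0L2 k) _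
    · exact (htc _).comp_stronglyMeasurable (stronglyMeasurable_iter h hlam hs hz0 k)
    · have hZ := memLp_iter h hlam hs hz0 hz0L2 k
      exact (integrable_decrease h hZ _).add
        (integrable_finsetSum _ fun j _ => (integrable_stepIncrement h hlam hZ _ j).const_mul _)
  obtain ⟨c, hc, hlow⟩ := exists_mul_norm_sq_le_gammaNorm_sq (d := d) hlam hρ h.L_pos
  filter_upwards [hconv] with ω hω
  refine exists_tendsto_of_forall_tendsto_quadratic hVc hc
    (add_nonneg zero_le_one (Finset.sum_nonneg fun i _ => weight_nonneg hlam hρ h.L_pos i))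
    hlow (gammaNorm_sq_le_mul_norm_sq hlam hρ h.L_pos) hdense (fun n => (hω n).1)
    fun z φ hφ hz => ?_
  have h0 : totalDecrease f L g lam p (s 0) z = 0 :=
    tendsto_nhds_unique (((htc (s 0)).tendsto z).comp hz) ((hω 0).2.comp hφ.tendsto_atTop)
  -- `idx 0 ω` serves only as some element of `Fin N`.
  exact mem_zer_of_totalDecrease_eq_zero h hlam hp (idx 0 ω) hstep (hsz 0) h0

end Iterates

end BasicMethod

/-! ### Conclusion and measurable choice of the limit -/

theorem theorem5p1 {Ω : Type*} [mΩ : MeasurableSpace Ω] (μ : Measure Ω) [IsProbabilityMeasure μ]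
    (ℱ : Filtration ℕ mΩ) {d N : ℕ}
    (f : Fin N → BasicMethod.Primal d → ℝ) (L : Fin N → ℝ) (g : BasicMethod.Primal d → EReal)
    (hfg : BasicMethod.ProblemAssumptions f L g)
    (lam : ℝ) (hlam : 0 < lam)
    (p ρ : Fin N → ℝ) (hp : ∀ i, 0 < p i) (hρ : ∀ i, 0 < ρ i)
    (idx : ℕ → Ω → Fin N) (eps : ℕ → Ω → Fin N → ℝ)
    (hsamp : BasicMethod.IsSampling μ ℱ p ρ idx eps)
    (z0 : Ω → BasicMethod.PrimalDual d N) (hz0 : StronglyMeasurable[ℱ 0] z0)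
    (hz0L2 : MemLp z0 2 μ) :
    (∀ zs ∈ BasicMethod.zer f g lam, ∀ k : ℕ,
      Integrable (fun ω => BasicMethod.gammaNorm lam ρ L
        (BasicMethod.iter f g lam p idx eps z0 (k + 1) ω - zs) ^ 2) μ ∧
      Integrable (BasicMethod.primalIncrement f g lam p idx eps z0 zs k) μ ∧
      μ[fun ω => BasicMethod.gammaNorm lam ρ L
          (BasicMethod.iter f g lam p idx eps z0 (k + 1) ω - zs) ^ 2 | ℱ k]
        ≤ᵐ[μ] fun ω => BasicMethod.gammaNorm lam ρ L
          (BasicMethod.iter f g lam p idx eps z0 k ω - zs) ^ 2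
            - BasicMethod.zeta μ ℱ f L g lam p idx eps z0 zs k ω) ∧
    ((∀ i, lam < (N : ℝ) * p i / (2 * L i)) →
      ∃ (zbar : Ω → BasicMethod.PrimalDual d N) (xbar : Ω → BasicMethod.Primal d),
        StronglyMeasurable zbar ∧ StronglyMeasurable xbar ∧
        (∀ ω, zbar ω ∈ BasicMethod.zer f g lam) ∧
        (∀ ω, xbar ω ∈ BasicMethod.solutionSet f g) ∧
        (∀ᵐ ω ∂μ, Tendsto (fun k => BasicMethod.iter f g lam p idx eps z0 k ω) atTop
          (𝓝 (zbar ω))) ∧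
        (∀ᵐ ω ∂μ, Tendsto (fun k => BasicMethod.primal
          (BasicMethod.iter f g lam p idx eps z0 k ω)) atTop (𝓝 (xbar ω))) ∧
        (∀ i, ∀ᵐ ω ∂μ, Tendsto (fun k => BasicMethod.dual
          (BasicMethod.iter f g lam p idx eps z0 k ω) i) atTop
            (𝓝 (∇ (f i) (xbar ω))))) := by
  open BasicMethod in
  refine ⟨fun zs hzs k => ⟨?_, ?_, ?_⟩, fun hstep => ?_⟩
  · exact integrable_gammaNorm_sub_sq hlam hρ hfg.L_pos
      (memLp_iter hfg hlam hsamp hz0 hz0L2 (k + 1)) zs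
  · exact Integrable.finite_choice
      (fun j => hsamp.measurable_idx' k (measurableSet_singleton j))
      fun j => integrable_stepIncrement hfg hlam (memLp_iter hfg hlam hsamp hz0 hz0L2 k) zs j
  · filter_upwards [condExp_gammaNorm_iter_le hfg hlam hp hρ hsamp hz0 hz0L2 hzs k,
      zeta_ae_eq hfg hlam hsamp hz0 hz0L2 zs k] with ω h1 h2
    rw [h2]
    exact h1
  · have hconv := ae_exists_tendsto_iter hfg hlam hp hρ hsamp hz0 hz0L2 hstep
    obtain ⟨zlim, hzlim, hlim⟩ := exists_stronglyMeasurable_limit_of_tendsto_ae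
      (f := iter f g lam p idx eps z0) (μ := μ)
      (fun k => (memLp_iter hfg hlam hsamp hz0 hz0L2 k).1)
      (hconv.mono fun ω ⟨z, _, hz⟩ => ⟨z, hz⟩)
    borelize (PrimalDual d N)
    have hmem : ∀ᵐ ω ∂μ, zlim ω ∈ zer f g lam := by
      filter_upwards [hconv, hlim] with ω ⟨z, hz, hz'⟩ hω
      rwa [tendsto_nhds_unique hω hz']
    -- The limit lies in the zero set only almost surely; as this set is closed and nonempty, a
    -- null-set modification places it there for every ω.
    obtain ⟨zbar, hzbar, hzer, heq⟩ := hzlim.aestronglyMeasurable.exists_stronglyMeasurable_range_subset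
      (hfg.isClosed_zer hlam).measurableSet (zer_nonempty hfg hlam) hmem
    have hz : ∀ᵐ ω ∂μ, Tendsto (fun k => iter f g lam p idx eps z0 k ω) atTop (𝓝 (zbar ω)) := by
      filter_upwards [hlim, heq] with ω h1 h2
      rwa [← h2]
    refine ⟨zbar, fun ω => primal (zbar ω), hzbar,
      continuous_primal.comp_stronglyMeasurable hzbar, hzer,
      fun ω => ((mem_zer_iff hfg hlam _).1 (hzer ω)).1, hz, ?_, fun i => ?_⟩
    · filter_upwards [hz] with ω hω
      exact (continuous_primal.tendsto _).comp hω
    · filter_upwards [hz] with ω hω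
      rw [← ((mem_zer_iff hfg hlam _).1 (hzer ω)).2 i]
      exact ((continuous_dual i).tendsto _).comp hω
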